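/- Let $\mathbb F$ be $\mathbb R$ or $\mathbb C$, let $T>0$, and let $g:\mathbb R\to\mathbb R$ be non-decreasing and left-continuous. Put $\Delta^+g(t)=g(t^+)-g(t)$, $D_g=\{t:\Delta^+g(t)>0\}$, and let $C_g$ be the (open) set of points around which $g$ is constant, with connected components $(a_m,b_m)$; $N_g^-$ and $N_g^+$ are the sets of the finite left, respectively right, endpoints of these components that are not in $D_g$. Assume that $g$ is continuous at $0$, $0\notin N_g^-$ and $T\notin C_g\cup N_g^+\cup D_g$. Let $g^B(t)=\sum_{s\in[0,t)\cap D_g}\Delta^+g(s)$ for $t>0$, $g^B(t)=-\sum_{s\in[t,0)\cap D_g}\Delta^+g(s)$ for $t\le 0$, and $g^C=g-g^B$. A function $v:[0,T]\to\mathbb F$ is $g$-continuous if for all $t\in[0,T]$, $\varepsilon>0$ there is $\delta>0$ with $|v(s)-v(t)|<\varepsilon$ whenever $s\in[0,T]$, $|g(s)-g(t)|<\delta$. Its $g$-derivative $v'_g(t)$ at $t\in[0,T]$ is $\lim_{s\to t}\frac{v(s)-v(t)}{g(s)-g(t)}$ (over $s\in[0,T]$ with $g(s)\ne g(t)$) if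 $t\notin D_g\cup C_g$, the same limit with $s\to t^+$ if $t\in D_g$, and $\lim_{s\to b_m^+}\frac{v(s)-v(b_m)}{g(s)-g(b_m)}$ if $t\in(a_m,b_m)\subset C_g$. For $k\ge 0$, $\mathcal{BC}_g^k=\mathcal{BC}_g^k([0,T];\mathbb F)$ is the set of $v$ for which $v$ and its first $k$ successive $g$-derivatives exist on all of $[0,T]$ and are bounded and $g$-continuous. $\mathcal{BC}^k_{g^C}$ is defined in the same way with $g^C$ in place of $g$ (a differentiability condition at a point where no difference quotient inside $[0,T]$ is available being regarded as empty; this does not occur if $0\notin N_{g^C}^-$ and $T\notin C_{g^C}\cup N_{g^C}^+$). Then, for every $v_0\in\mathbb F$: 1. If $n\ge1$, $\beta\in\mathcal{BC}_g^n\cap\mathcal{BC}_{g^C}^{n-1}$ and $f\in\mathcal{BC}_g^n$, then the problem $v'_g(t)=\beta(t)v(t)+f(t)$ for all $t\in[0,T]$, $v(0)=v_0$, has a unique solution in $\mathcal{BC}_g^{n+1}$. 2. If $n\ge1$ and $\beta\in\mathcal{BC}_g^n\cap\mathcal{BC}_{g^C}^{n-1}$, then the problem $v'_g(t)=\beta(t)v(t)$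 for all $t\in[0,T]$, $v(0)=v_0$, has a unique solution in $\mathcal{BC}_g^{n+1}$. 3. If $\beta\in\mathcal{BC}_g^0$, then the problem $v'_g(t)=\beta(t)v(t)$ for all $t\in[0,T]$, $v(0)=v_0$, has a unique solution in $\mathcal{BC}_g^{1}$. -/

import Mathlib

open Set Filter Topology

noncomputable section

namespace Stieltjes

/-- A derivator: a left-continuous non-decreasing function `g : ℝ → ℝ`. -/
structure IsDerivator (g : ℝ → ℝ) : Prop where
  monotone : Monotone g
  leftCts : ∀ t, ContinuousWithinAt g (Iic t) t

/-- The jump `Δ⁺g(t) = g(t⁺) - g(t)`. -/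
def jump (g : ℝ → ℝ) (t : ℝ) : ℝ := Function.rightLim g t - g t

/-- The set `D_g` of discontinuity points of `g`. -/
def jumpSet (g : ℝ → ℝ) : Set ℝ := {t | 0 < jump g t}

/-- The set `C_g` of points around which `g` is constant. -/
def constSet (g : ℝ → ℝ) : Set ℝ :=
  {t | ∃ ε > 0, ∀ s ∈ Ioo (t - ε) (t + ε), g s = g t}

/-- `N_g⁻`: the left endpoints of the connected components of the open set `C_g`, minus `D_g`. -/
def leftEnds (g : ℝ → ℝ) : Set ℝ :=
  {t | t ∉ constSet g ∧ ∃ ε > 0, Ioo t (t + ε) ⊆ constSet g} \ jumpSet g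

/-- `N_g⁺`: the right endpoints of the connected components of the open set `C_g`, minus `D_g`. -/
def rightEnds (g : ℝ → ℝ) : Set ℝ :=
  {t | t ∉ constSet g ∧ ∃ ε > 0, Ioo (t - ε) t ⊆ constSet g} \ jumpSet g

/-- `d` is the right endpoint of the connected component of `C_g` that contains `t`. -/
def IsRightEndOf (g : ℝ → ℝ) (t d : ℝ) : Prop :=
  t < d ∧ Ico t d ⊆ constSet g ∧ d ∉ constSet g

/-- The jump part `g^B` of `g`, based at `a`. -/
def jumpPart (g : ℝ → ℝ) (a t : ℝ) : ℝ :=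
  if a < t then ∑' s : ↥(Ico a t ∩ jumpSet g), jump g s
  else -∑' s : ↥(Ico t a ∩ jumpSet g), jump g s

/-- The continuous part `g^C = g - g^B` of `g`, based at `a`. -/
def contPart (g : ℝ → ℝ) (a t : ℝ) : ℝ := g t - jumpPart g a t

variable {𝕜 : Type*} [RCLike 𝕜]

/-- The difference quotient `(f(s) - f(t)) / (g(s) - g(t))`. -/
def quot (g : ℝ → ℝ) (f : ℝ → 𝕜) (t s : ℝ) : 𝕜 := (f s - f t) / ((g s - g t : ℝ) : 𝕜)

/-- `f : [a, b] → 𝕜` (only the values on `[a, b]` matter) has `g`-derivative `f'` at `t ∈ [a, b]`.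

* At `t ∉ D_g ∪ C_g` the quotient tends to `f'` as `s → t` within its domain, the points
  `s ∈ [a, b]` with `g s ≠ g t`; at the points of `N_g⁺` and `N_g⁻` this is automatically the limit
  from the right and from the left, respectively.
* At `t ∈ D_g` it is the limit from the right.
* At `t ∈ C_g` it is the limit from the right at the right endpoint of the component of `t`.

All these limits are taken along proper filters if `a ∉ N_g⁻` and `b ∉ C_g ∪ N_g⁺ ∪ D_g`. For other
derivators a condition at a point where no increment inside `[a, b]` is available is empty. -/
def HasGDerivAt (g : ℝ → ℝ) (a b : ℝ) (f : ℝ → 𝕜) (f' : 𝕜) (t : ℝ) : Prop :=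
  (t ∉ jumpSet g ∪ constSet g →
    Tendsto (quot g f t) (𝓝[{s | s ∈ Icc a b ∧ g s ≠ g t}] t) (𝓝 f')) ∧
  (t ∈ jumpSet g → Tendsto (quot g f t) (𝓝[Ioi t ∩ Icc a b] t) (𝓝 f')) ∧
  (t ∈ constSet g → ∀ d, IsRightEndOf g t d →
    Tendsto (quot g f d) (𝓝[Ioi d ∩ Icc a b] d) (𝓝 f'))

/-- `f` is `g`-continuous on `[a, b]`. -/
def GContinuousOn (g : ℝ → ℝ) (a b : ℝ) (f : ℝ → 𝕜) : Prop :=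
  ∀ t ∈ Icc a b, ∀ ε > 0, ∃ δ > 0, ∀ s ∈ Icc a b, |g t - g s| < δ → ‖f t - f s‖ < ε

/-- `f ∈ BC_g^k([a, b]; 𝕜)`: `f` and its first `k` successive `g`-derivatives exist at every point
of `[a, b]` and are bounded and `g`-continuous there. -/
def MemBC (g : ℝ → ℝ) (a b : ℝ) : ℕ → (ℝ → 𝕜) → Prop
  | 0, f => GContinuousOn g a b f ∧ ∃ M : ℝ, ∀ t ∈ Icc a b, ‖f t‖ ≤ M
  | k + 1, f => (GContinuousOn g a b f ∧ ∃ M : ℝ, ∀ t ∈ Icc a b, ‖f t‖ ≤ M) ∧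
      ∃ h : ℝ → 𝕜, (∀ t ∈ Icc a b, HasGDerivAt g a b f (h t) t) ∧ MemBC g a b k h

/-- `v` satisfies `v'_g(t) = F(t, v(t))` at every point `t ∈ [0, T]`, and `v(0) = v₀`. -/
def IsSolution (g : ℝ → ℝ) (T : ℝ) (F : ℝ → 𝕜 → 𝕜) (v₀ : 𝕜) (v : ℝ → 𝕜) : Prop :=
  v 0 = v₀ ∧ ∀ t ∈ Icc 0 T, HasGDerivAt g 0 T v (F t (v t)) t

/-- The problem `v'_g = F(t, v)` on `[0, T]`, `v(0) = v₀`, has exactly one solution in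
`BC_g^k([0, T]; 𝕜)`; functions on `[0, T]` are equal when they agree at every point of `[0, T]`. -/
def HasUniqueSolutionInBC (g : ℝ → ℝ) (T : ℝ) (k : ℕ) (F : ℝ → 𝕜 → 𝕜) (v₀ : 𝕜) : Prop :=
  ∃ v : ℝ → 𝕜, (MemBC g 0 T k v ∧ IsSolution g T F v₀ v) ∧
    ∀ w : ℝ → 𝕜, MemBC g 0 T k w ∧ IsSolution g T F v₀ w → EqOn w v (Icc 0 T)

end Stieltjes

end

/-! Existence and uniqueness come from the Picard scheme for `v = v₀ + ∫_{[0,t)} (β v + f) dμ_g`.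
The `n`-fold iterated integrals of `1` are at most `(g T - g 0)^n / n!` even when `μ_g` has atoms
(`succ_mul_iterInt_le`), so the series converges uniformly (`RegularOn.exists_solution`) and the
difference of two solutions vanishes (`RegularOn.solution_unique`).

The real issue is regularity. Bootstrapping `v' = β v + f` requires `β v` to be as smooth as `v`,
but the product rule `(β v)' = β' v + β v' + β' Δ⁺g v'` contains `Δ⁺g`, which need not be
`g`-continuous. `GoodMul` asks that `β' Δ⁺g` agree off `C_g` with a function that is again a
multiplier; `RegularOn.goodMul` obtains this from the two smoothness hypotheses.

A `g^C`-continuous `β` does not jump, so `β' = 0` on `D_g`. Where `g^C > g^C(0)`, all higher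
derivatives vanish on `D_g` too (`RegularOn.vanish`). Indeed, once a derivative vanishes at these
jumps, its integral against `μ_g` sees only `g^C`; it therefore coincides with the `g^C`-derivative
at the points where `g^C` increases from the left, and the latter, being `g^C`-continuous, does not
jump.

The initial level of `g^C` contains no such points, and higher derivatives may be nonzero at its
jumps. But `β` is constant there. If these jumps have a last one `c`, each derivative is on `[0, c]`
a combination of indicators of levels of `g` that end with a jump; such combinations can be
differentiated, at the cost of one order, and multiplied by `Δ⁺g` (`RegularOn.goodMul_of_vanish`).
If there is no last jump, all derivatives vanish at the jumps of the initial level. -/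

noncomputable section

open MeasureTheory

namespace Stieltjes

variable {𝕜 : Type*} [RCLike 𝕜] {g : ℝ → ℝ} {T : ℝ}

/-! ### Derivators and their level sets on `[0, T]` -/

/-- A derivator for which every `g`-derivative on `[0, T]` is a limit along a proper filter. -/
structure RegularOn (g : ℝ → ℝ) (T : ℝ) : Prop extends IsDerivator g where
  pos : 0 < T
  notMem_leftEnds : (0 : ℝ) ∉ leftEnds g
  notMem_right : T ∉ constSet g ∪ rightEnds g ∪ jumpSet g

lemma IsDerivator.jump_nonneg (hg : IsDerivator g) (t : ℝ) : 0 ≤ jump g t :=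
  sub_nonneg.2 (hg.monotone.le_rightLim le_rfl)

lemma IsDerivator.add_jump_le (hg : IsDerivator g) {s t : ℝ} (h : t < s) : g t + jump g t ≤ g s := by
  have := hg.monotone.rightLim_le h
  unfold jump; linarith

lemma IsDerivator.lt_of_mem_jumpSet (hg : IsDerivator g) {s t : ℝ} (ht : t ∈ jumpSet g)
    (h : t < s) : g t < g s := by
  have h1 := hg.add_jump_le h
  have h2 : 0 < jump g t := ht
  linarith

lemma IsDerivator.leftLim_eq (hg : IsDerivator g) (t : ℝ) : Function.leftLim g t = g t :=
  leftLim_eq_of_tendsto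
    ((hg.leftCts t).tendsto.mono_left (nhdsWithin_mono _ Iio_subset_Iic_self))

lemma IsDerivator.jump_eq_zero (hg : IsDerivator g) {t : ℝ} (ht : t ∉ jumpSet g) : jump g t = 0 :=
  le_antisymm (not_lt.1 ht) (hg.jump_nonneg t)

lemma IsDerivator.continuousAt (hg : IsDerivator g) {t : ℝ} (ht : t ∉ jumpSet g) :
    ContinuousAt g t := by
  rw [hg.monotone.continuousAt_iff_leftLim_eq_rightLim, hg.leftLim_eq]
  have := hg.jump_eq_zero ht
  unfold jump at this; linarith

lemma IsDerivator.tendsto_Ioi (hg : IsDerivator g) (t : ℝ) :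
    Tendsto g (𝓝[>] t) (𝓝 (g t + jump g t)) := by
  have := hg.monotone.tendsto_rightLim t
  simpa [jump] using this

lemma eventually_eq_of_mem_constSet {t : ℝ} (ht : t ∈ constSet g) : ∀ᶠ s in 𝓝 t, g s = g t := by
  obtain ⟨ε, hε, h⟩ := ht
  filter_upwards [Ioo_mem_nhds (show t - ε < t by linarith) (show t < t + ε by linarith)] with s hs
    using h s hs

lemma mem_constSet_of_lt (hg : Monotone g) {t x y : ℝ} (hx : x < t) (hy : t < y) (h : g x = g y) :
    t ∈ constSet g := by
  refine ⟨min (t - x) (y - t), lt_min (by linarith) (by linarith), fun s hs => ?_⟩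
  have h1 := min_le_left (t - x) (y - t)
  have h2 := min_le_right (t - x) (y - t)
  have a1 := hg (show x ≤ s by linarith [hs.1])
  have a2 := hg (show s ≤ y by linarith [hs.2])
  have a3 := hg hx.le
  have a4 := hg hy.le
  linarith

lemma IsDerivator.notMem_jumpSet (hg : IsDerivator g) {t : ℝ} (ht : t ∈ constSet g) :
    t ∉ jumpSet g := by
  intro hD
  obtain ⟨ε, hε, h⟩ := ht
  have := hg.lt_of_mem_jumpSet hD (show t < t + ε / 2 by linarith)
  exact this.ne' (h _ ⟨by linarith, by linarith⟩)

lemma RegularOn.notMem_jumpSet_right (hg : RegularOn g T) : T ∉ jumpSet g :=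
  fun h => hg.notMem_right (Or.inr h)

lemma RegularOn.notMem_constSet_right (hg : RegularOn g T) : T ∉ constSet g :=
  fun h => hg.notMem_right (Or.inl (Or.inl h))

/-- If `g` were constant on `[y, T]`, then `T`, lying neither in `C_g` nor in `D_g`, would belong to
`N_g⁺`. -/
lemma RegularOn.lt_right (hg : RegularOn g T) {y : ℝ} (hy : y < T) : g y < g T := by
  refine lt_of_le_of_ne (hg.monotone hy.le) fun h => hg.notMem_right (Or.inl (Or.inr ⟨⟨?_, T - y,
    by linarith, ?_⟩, hg.notMem_jumpSet_right⟩))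
  · exact hg.notMem_constSet_right
  · intro s hs
    exact mem_constSet_of_lt hg.monotone (show y < s by linarith [hs.1]) hs.2 h

/-- The largest point of the level set of `x`. -/
lemma RegularOn.exists_top (hg : RegularOn g T) {x : ℝ} (hx : x < T) :
    ∃ d ∈ Ico x T, g d = g x ∧ ∀ s, d < s → g x < g s := by
  set S := {s | s ∈ Icc x T ∧ g s = g x} with hS
  have hne : S.Nonempty := ⟨x, ⟨le_rfl, hx.le⟩, rfl⟩
  have hbd : BddAbove S := ⟨T, fun s hs => hs.1.2⟩
  set d := sSup S
  have hxd : x ≤ d := le_csSup hbd ⟨⟨le_rfl, hx.le⟩, rfl⟩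
  have hdT : d ≤ T := csSup_le hne fun s hs => hs.1.2
  -- Points of the level approach `d` from the left, so left continuity puts `d` on it.
  have hgd : g d = g x := by
    have hcl : d ∈ closure S := csSup_mem_closure hne hbd
    have : ∃ᶠ s in 𝓝[≤] d, g s = g x := by
      rw [mem_closure_iff_frequently] at hcl
      rw [nhdsWithin, frequently_inf_principal]
      exact hcl.mono fun s hs => ⟨le_csSup hbd hs, hs.2⟩
    by_contra hne
    exact this ((hg.leftCts d).eventually_ne hne)
  refine ⟨d, ⟨hxd, lt_of_le_of_ne hdT fun h => ?_⟩, hgd, fun s hs => ?_⟩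
  · have := hg.lt_right hx
    rw [← h, hgd] at this
    exact lt_irrefl _ this
  · by_contra hle
    have hle := not_lt.1 hle
    have h1 : g s = g x := le_antisymm hle (hg.monotone (hxd.trans hs.le))
    rcases le_or_gt s T with h2 | h2
    · exact absurd (le_csSup hbd ⟨⟨hxd.trans hs.le, h2⟩, h1⟩) (not_le.2 hs)
    · have := hg.lt_right hx
      have := hg.monotone h2.le
      linarith

lemma notMem_constSet_of_forall_lt {x : ℝ} (h : ∀ s, x < s → g x < g s) : x ∉ constSet g := by
  rintro ⟨ε, hε, h'⟩
  have := h (x + ε / 2) (by linarith)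
  exact this.ne' (h' _ ⟨by linarith, by linarith⟩)

/-- The top of the level of `t` has strictly larger values to its right, hence lies outside `C_g`
and must be the right endpoint of the component. -/
lemma RegularOn.isRightEndOf (hg : RegularOn g T) {t d : ℝ} (ht : t ∈ Icc 0 T)
    (hd : IsRightEndOf g t d) :
    d ∈ Ico t T ∧ g d = g t ∧ ∀ s, d < s → g d < g s := by
  obtain ⟨h1, h2, h3⟩ := hd
  have htT : t < T := by
    refine lt_of_le_of_ne ht.2 ?_
    rintro rfl
    exact hg.notMem_constSet_right (h2 ⟨le_rfl, h1⟩)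
  obtain ⟨e, he, hge, hgt⟩ := hg.exists_top htT
  have hec : e ∉ constSet g := notMem_constSet_of_forall_lt fun s hs => hge ▸ hgt s hs
  have hde : d = e := by
    rcases lt_trichotomy d e with h | h | h
    · exact absurd (mem_constSet_of_lt hg.monotone h1 h hge.symm) h3
    · exact h
    · exact absurd (h2 ⟨he.1, h⟩) hec
  subst hde
  exact ⟨he, hge, fun s hs => hge ▸ hgt s hs⟩

/-! ### The filter of the `g`-derivative -/

/-- The filter along which the `g`-derivative at `t ∉ C_g` is computed. -/
def gFilter (g : ℝ → ℝ) (T t : ℝ) : Filter ℝ :=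
  open Classical in
  if t ∈ jumpSet g then 𝓝[Ioi t ∩ Icc 0 T] t else 𝓝[{s | s ∈ Icc 0 T ∧ g s ≠ g t}] t

lemma gFilter_of_mem {t : ℝ} (ht : t ∈ jumpSet g) : gFilter g T t = 𝓝[Ioi t ∩ Icc 0 T] t :=
  if_pos ht

lemma gFilter_of_notMem {t : ℝ} (ht : t ∉ jumpSet g) :
    gFilter g T t = 𝓝[{s | s ∈ Icc 0 T ∧ g s ≠ g t}] t :=
  if_neg ht

lemma hasGDerivAt_iff {f : ℝ → 𝕜} {f' : 𝕜} {t : ℝ} (ht : t ∉ constSet g) :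
    HasGDerivAt g 0 T f f' t ↔ Tendsto (quot g f t) (gFilter g T t) (𝓝 f') := by
  by_cases hD : t ∈ jumpSet g
  · simp [HasGDerivAt, gFilter_of_mem, hD, ht]
  · simp [HasGDerivAt, gFilter_of_notMem, hD, ht]

lemma gFilter_le (t : ℝ) : gFilter g T t ≤ 𝓝[Icc 0 T] t := by
  unfold gFilter
  split_ifs
  · exact nhdsWithin_mono _ inter_subset_right
  · exact nhdsWithin_mono _ fun s hs => hs.1

lemma IsDerivator.eventually_ne (hg : IsDerivator g) (t : ℝ) :
    ∀ᶠ s in gFilter g T t, g s ≠ g t := by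
  by_cases hD : t ∈ jumpSet g
  · rw [gFilter_of_mem hD]
    filter_upwards [self_mem_nhdsWithin] with s hs using (hg.lt_of_mem_jumpSet hD hs.1).ne'
  · rw [gFilter_of_notMem hD]
    filter_upwards [self_mem_nhdsWithin] with s hs using hs.2

lemma IsDerivator.tendsto_gFilter (hg : IsDerivator g) (t : ℝ) :
    Tendsto g (gFilter g T t) (𝓝 (g t + jump g t)) := by
  by_cases hD : t ∈ jumpSet g
  · rw [gFilter_of_mem hD]
    exact (hg.tendsto_Ioi t).mono_left (nhdsWithin_mono _ inter_subset_left)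
  · rw [gFilter_of_notMem hD, hg.jump_eq_zero hD, add_zero]
    exact (hg.continuousAt hD).tendsto.mono_left nhdsWithin_le_nhds

/-- Shows that the filter is proper at the top of a level and lets limits there be tested from the
right. -/
lemma nhdsWithin_Ioi_le_gFilter {t : ℝ} (ht0 : 0 ≤ t) (htT : t < T)
    (h : ∀ s, t < s → g t < g s) : 𝓝[>] t ≤ gFilter g T t := by
  have key : ∀ᶠ s in 𝓝[>] t, s ∈ Ioo t T := Ioo_mem_nhdsGT htT
  unfold gFilter
  split_ifs
  · refine le_inf nhdsWithin_le_nhds (le_principal_iff.2 ?_)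
    filter_upwards [key] with s hs using ⟨hs.1, ht0.trans hs.1.le, hs.2.le⟩
  · refine le_inf nhdsWithin_le_nhds (le_principal_iff.2 ?_)
    filter_upwards [key] with s hs using ⟨⟨ht0.trans hs.1.le, hs.2.le⟩, (h s hs.1).ne'⟩

lemma quot_mul_sub {f : ℝ → 𝕜} {s t : ℝ} (h : g s ≠ g t) :
    quot g f t s * ((g s - g t : ℝ) : 𝕜) = f s - f t := by
  unfold quot
  rw [div_mul_cancel₀]
  exact_mod_cast sub_ne_zero.2 h

/-- Along its filter, a `g`-differentiable function tends to its value plus its jump. -/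
lemma IsDerivator.tendsto_of_quot (hg : IsDerivator g) {f : ℝ → 𝕜} {f' : 𝕜} {t : ℝ}
    (h : Tendsto (quot g f t) (gFilter g T t) (𝓝 f')) :
    Tendsto f (gFilter g T t) (𝓝 (f t + f' * (jump g t : 𝕜))) := by
  have h1 : Tendsto (fun s => ((g s - g t : ℝ) : 𝕜)) (gFilter g T t) (𝓝 ((jump g t : ℝ) : 𝕜)) := by
    have : Tendsto (fun s => g s - g t) (gFilter g T t) (𝓝 (jump g t)) := by
      simpa using (hg.tendsto_gFilter (T := T) t).sub_const (g t)
    exact (RCLike.continuous_ofReal.tendsto _).comp this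
  refine ((h.mul h1).const_add (f t)).congr' ?_
  filter_upwards [hg.eventually_ne t] with s hs
  rw [quot_mul_sub hs]; ring

/-! ### `g`-continuity and the mean value inequality -/

section GContinuous

variable {f h : ℝ → 𝕜}

lemma GContinuousOn.eq_of_eq {a b : ℝ} (hf : GContinuousOn g a b f) {s t : ℝ} (hs : s ∈ Icc a b)
    (ht : t ∈ Icc a b) (hst : g s = g t) : f s = f t := by
  by_contra hne
  obtain ⟨δ, hδ, h⟩ := hf t ht ‖f t - f s‖ (norm_pos_iff.2 (sub_ne_zero.2 (Ne.symm hne)))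
  exact lt_irrefl _ (h s hs (by simpa [hst] using hδ))

lemma GContinuousOn.tendsto {a b : ℝ} (hf : GContinuousOn g a b f) {t : ℝ} (ht : t ∈ Icc a b)
    {l : Filter ℝ} (hl : ∀ᶠ s in l, s ∈ Icc a b) (hgl : Tendsto g l (𝓝 (g t))) :
    Tendsto f l (𝓝 (f t)) := by
  rw [Metric.tendsto_nhds]
  intro ε hε
  obtain ⟨δ, hδ, h⟩ := hf t ht ε hε
  filter_upwards [hl, Metric.tendsto_nhds.1 hgl δ hδ] with s hs hs'
  rw [dist_comm, dist_eq_norm]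
  refine h s hs ?_
  rwa [dist_comm, Real.dist_eq] at hs'

lemma GContinuousOn.continuousWithinAt_left {a b : ℝ} (hf : GContinuousOn g a b f)
    (hg : IsDerivator g) {t : ℝ} (ht : t ∈ Icc a b) : ContinuousWithinAt f (Icc a b ∩ Iic t) t := by
  refine hf.tendsto ht ?_ ((hg.leftCts t).tendsto.mono_left (nhdsWithin_mono _ inter_subset_right))
  filter_upwards [self_mem_nhdsWithin] with s hs using hs.1

lemma gContinuousOn_of_lipschitz {a b K : ℝ}
    (h : ∀ s ∈ Icc a b, ∀ t ∈ Icc a b, ‖f t - f s‖ ≤ K * |g t - g s|) : GContinuousOn g a b f := by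
  intro t ht ε hε
  refine ⟨ε / (|K| + 1), by positivity, fun s hs hst => ?_⟩
  rw [lt_div_iff₀ (by positivity)] at hst
  have h1 := h s hs t ht
  have h2 : K * |g t - g s| ≤ |K| * |g t - g s| :=
    mul_le_mul_of_nonneg_right (le_abs_self K) (abs_nonneg _)
  rcases (abs_nonneg (g t - g s)).eq_or_lt with h3 | h3
  · rw [← h3, mul_zero] at h1; linarith
  · nlinarith

lemma MemBC.toZero {a b : ℝ} {n : ℕ} (hf : MemBC g a b n f) : MemBC g a b 0 f := by
  cases n with
  | zero => exact hf
  | succ n => exact hf.1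

lemma MemBC.gContinuousOn {a b : ℝ} {n : ℕ} (hf : MemBC g a b n f) : GContinuousOn g a b f :=
  hf.toZero.1

lemma MemBC.exists_bound {a b : ℝ} {n : ℕ} (hf : MemBC g a b n f) :
    ∃ M : ℝ, 0 ≤ M ∧ ∀ t ∈ Icc a b, ‖f t‖ ≤ M := by
  obtain ⟨M, hM⟩ := hf.toZero.2
  exact ⟨max M 0, le_max_right _ _, fun t ht => (hM t ht).trans (le_max_left _ _)⟩

/-- `g`-continuity is continuity for the topology induced by `g`; in this form sums and products are
inherited from `Tendsto`. -/
lemma gContinuousOn_iff {a b : ℝ} : GContinuousOn g a b f ↔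
    ∀ t ∈ Icc a b, Tendsto f (comap g (𝓝 (g t)) ⊓ 𝓟 (Icc a b)) (𝓝 (f t)) := by
  refine ⟨fun hf t ht => hf.tendsto ht (mem_inf_of_right (mem_principal_self _))
    (tendsto_comap.mono_left inf_le_left), fun H t ht ε hε => ?_⟩
  have h1 := Metric.tendsto_nhds.1 (H t ht) ε hε
  rw [eventually_inf_principal, eventually_comap, Metric.eventually_nhds_iff] at h1
  obtain ⟨δ, hδ, h2⟩ := h1
  refine ⟨δ, hδ, fun s hs hst => ?_⟩
  have := h2 (y := g s) (by rwa [dist_comm, Real.dist_eq]) s rfl hs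
  rwa [dist_comm, dist_eq_norm] at this

lemma MemBC.add_zero {a b : ℝ} (hf : MemBC g a b 0 f) (hh : MemBC g a b 0 h) :
    MemBC g a b 0 (fun t => f t + h t) := by
  obtain ⟨M, -, hM⟩ := hf.exists_bound
  obtain ⟨N, -, hN⟩ := hh.exists_bound
  refine ⟨gContinuousOn_iff.2 fun t ht => (gContinuousOn_iff.1 hf.1 t ht).add
    (gContinuousOn_iff.1 hh.1 t ht), M + N, fun t ht => ?_⟩
  exact (norm_add_le _ _).trans (add_le_add (hM t ht) (hN t ht))

lemma MemBC.mul_zero {a b : ℝ} (hf : MemBC g a b 0 f) (hh : MemBC g a b 0 h) :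
    MemBC g a b 0 (fun t => f t * h t) := by
  obtain ⟨M, hM0, hM⟩ := hf.exists_bound
  obtain ⟨N, -, hN⟩ := hh.exists_bound
  refine ⟨gContinuousOn_iff.2 fun t ht => (gContinuousOn_iff.1 hf.1 t ht).mul
    (gContinuousOn_iff.1 hh.1 t ht), M * N, fun t ht => ?_⟩
  rw [norm_mul]
  exact mul_le_mul (hM t ht) (hN t ht) (norm_nonneg _) hM0

lemma memBC_zero_const {a b : ℝ} (x : 𝕜) : MemBC g a b 0 (fun _ => x) :=
  ⟨gContinuousOn_iff.2 fun _ _ => tendsto_const_nhds, ‖x‖, fun _ _ => le_rfl⟩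

/-- A `g`-continuous candidate needs to be tested only outside of `C_g`. -/
lemma RegularOn.hasGDerivAt_of_notMem_constSet (hg : RegularOn g T) (hh : GContinuousOn g 0 T h)
    (H : ∀ t ∈ Icc 0 T, t ∉ constSet g → Tendsto (quot g f t) (gFilter g T t) (𝓝 (h t))) :
    ∀ t ∈ Icc 0 T, HasGDerivAt g 0 T f (h t) t := by
  intro t ht
  by_cases hC : t ∈ constSet g
  · refine ⟨fun h => absurd (Or.inr hC) h, fun h => absurd h (hg.notMem_jumpSet hC),
      fun _ d hd => ?_⟩
    obtain ⟨hdT, hgd, hlt⟩ := hg.isRightEndOf ht hd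
    have hd0 : d ∈ Icc 0 T := ⟨ht.1.trans hdT.1, hdT.2.le⟩
    -- The right endpoint `d` lies on the level of `t`, where `h` is constant.
    rw [hh.eq_of_eq ht hd0 hgd.symm]
    refine (H d hd0 hd.2.2).mono_left (le_trans ?_ (nhdsWithin_Ioi_le_gFilter hd0.1 hdT.2 hlt))
    exact nhdsWithin_mono _ inter_subset_left
  · exact (hasGDerivAt_iff hC).2 (H t ht hC)

lemma RegularOn.tendsto_quot (hg : RegularOn g T)
    (H : ∀ t ∈ Icc 0 T, HasGDerivAt g 0 T f (h t) t) {t : ℝ} (ht : t ∈ Icc 0 T)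
    (hC : t ∉ constSet g) : Tendsto (quot g f t) (gFilter g T t) (𝓝 (h t)) :=
  (hasGDerivAt_iff hC).1 (H t ht)

/-- First-order expansion to the right of any point. -/
lemma RegularOn.eventually_norm_sub_le (hg : RegularOn g T) (hf : GContinuousOn g 0 T f)
    (H : ∀ t ∈ Icc 0 T, HasGDerivAt g 0 T f (h t) t) {x : ℝ} (hx : x ∈ Ico 0 T) {ε : ℝ}
    (hε : 0 < ε) :
    ∀ᶠ s in 𝓝[>] x, ‖f s - f x - h x * ((g s - g x : ℝ) : 𝕜)‖ ≤ ε * (g s - g x) := by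
  have hx' : x ∈ Icc 0 T := ⟨hx.1, hx.2.le⟩
  have triv : ∀ s, s ∈ Ioo x T → g s = g x →
      ‖f s - f x - h x * ((g s - g x : ℝ) : 𝕜)‖ ≤ ε * (g s - g x) := by
    intro s hs hgs
    rw [hf.eq_of_eq (s := s) (t := x) ⟨hx.1.trans hs.1.le, hs.2.le⟩ hx' hgs, hgs]
    simp
  have key : ∀ᶠ s in 𝓝[>] x, s ∈ Ioo x T := Ioo_mem_nhdsGT hx.2
  by_cases hC : x ∈ constSet g
  · filter_upwards [key, nhdsWithin_le_nhds (eventually_eq_of_mem_constSet hC)] with s hs hgs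
      using triv s hs hgs
  have hq := Metric.tendsto_nhds.1 (hg.tendsto_quot H hx' hC) ε hε
  have hq' : ∀ᶠ s in 𝓝[>] x, g s ≠ g x → dist (quot g f x s) (h x) < ε := by
    by_cases hD : x ∈ jumpSet g
    · rw [gFilter_of_mem hD, eventually_nhdsWithin_iff] at hq
      filter_upwards [key, nhdsWithin_le_nhds hq] with s hs h1 _
        using h1 ⟨hs.1, hx.1.trans hs.1.le, hs.2.le⟩
    · rw [gFilter_of_notMem hD, eventually_nhdsWithin_iff] at hq
      filter_upwards [key, nhdsWithin_le_nhds hq] with s hs h1 h2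
        using h1 ⟨⟨hx.1.trans hs.1.le, hs.2.le⟩, h2⟩
  filter_upwards [key, hq'] with s hs h1
  by_cases hgs : g s = g x
  · exact triv s hs hgs
  · have h2 := h1 hgs
    have h3 : 0 ≤ g s - g x := sub_nonneg.2 (hg.monotone hs.1.le)
    rw [← quot_mul_sub hgs, ← sub_mul, norm_mul, RCLike.norm_ofReal, abs_of_nonneg h3]
    rw [dist_eq_norm] at h2
    exact mul_le_mul_of_nonneg_right h2.le h3

/-- Mean value inequality for a vanishing `g`-derivative. -/
lemma RegularOn.eq_of_deriv_zero (hg : RegularOn g T) (hf : GContinuousOn g 0 T f)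
    (H : ∀ t ∈ Icc 0 T, HasGDerivAt g 0 T f 0 t) {t : ℝ} (ht : t ∈ Icc 0 T) : f t = f 0 := by
  suffices h : ∀ ε > 0, ‖f t - f 0‖ ≤ ε * (g t - g 0) by
    have h0 : ‖f t - f 0‖ ≤ 0 := by
      refine le_of_forall_pos_le_add fun δ hδ => ?_
      have hm : 0 ≤ g t - g 0 := sub_nonneg.2 (hg.monotone ht.1)
      have := h (δ / (g t - g 0 + 1)) (by positivity)
      refine this.trans ?_
      rw [zero_add, div_mul_eq_mul_div, div_le_iff₀ (by positivity)]
      nlinarith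
    exact sub_eq_zero.1 (norm_le_zero_iff.1 h0)
  intro ε hε
  -- Continuous induction: left continuity of `f` and `g` puts the supremum in `S`, and the
  -- expansion to its right moves past it unless it is `T`.
  set S := {x | x ∈ Icc 0 T ∧ ∀ s ∈ Icc 0 x, ‖f s - f 0‖ ≤ ε * (g s - g 0)} with hS
  have h0S : (0 : ℝ) ∈ S := by
    refine ⟨⟨le_rfl, hg.pos.le⟩, fun s hs => ?_⟩
    have : s = 0 := le_antisymm hs.2 hs.1
    simp [this]
  have hbd : BddAbove S := ⟨T, fun s hs => hs.1.2⟩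
  set x := sSup S
  have hx0 : 0 ≤ x := le_csSup hbd h0S
  have hxT : x ≤ T := csSup_le ⟨0, h0S⟩ fun s hs => hs.1.2
  have hlt : ∀ s, 0 ≤ s → s < x → ‖f s - f 0‖ ≤ ε * (g s - g 0) := by
    intro s hs0 hsx
    obtain ⟨y, hy, hsy⟩ := exists_lt_of_lt_csSup ⟨0, h0S⟩ hsx
    exact hy.2 s ⟨hs0, hsy.le⟩
  have hxx : ‖f x - f 0‖ ≤ ε * (g x - g 0) := by
    rcases hx0.eq_or_lt with h | h
    · rw [← h]; simp
    · have hle : 𝓝[<] x ≤ 𝓝[Icc 0 T ∩ Iic x] x := by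
        refine le_inf nhdsWithin_le_nhds (le_principal_iff.2 ?_)
        filter_upwards [Ioo_mem_nhdsLT h] with s hs
          using ⟨⟨hs.1.le, hs.2.le.trans hxT⟩, hs.2.le⟩
      have h1 : Tendsto f (𝓝[<] x) (𝓝 (f x)) :=
        (hf.continuousWithinAt_left hg.toIsDerivator ⟨hx0, hxT⟩).tendsto.mono_left hle
      have h2 : Tendsto g (𝓝[<] x) (𝓝 (g x)) :=
        (hg.leftCts x).tendsto.mono_left (nhdsWithin_mono _ Iio_subset_Iic_self)
      refine le_of_tendsto_of_tendsto (h1.sub_const _).norm ((h2.sub_const _).const_mul ε) ?_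
      filter_upwards [Ioo_mem_nhdsLT h] with s hs using hlt s hs.1.le hs.2
  have hxS : x ∈ S := by
    refine ⟨⟨hx0, hxT⟩, fun s hs => ?_⟩
    rcases hs.2.eq_or_lt with h | h
    · rw [h]; exact hxx
    · exact hlt s hs.1 h
  rcases hxT.eq_or_lt with h | h
  · exact hxS.2 t ⟨ht.1, h ▸ ht.2⟩
  · exfalso
    have h1 := hg.eventually_norm_sub_le (h := fun _ => 0) hf H ⟨hx0, h⟩ hε
    obtain ⟨y, hy, hy'⟩ := (mem_nhdsGT_iff_exists_Ioc_subset).1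
      (inter_mem h1 (Ioo_mem_nhdsGT h))
    have hyS : y ∈ S := by
      refine ⟨⟨hx0.trans (le_of_lt hy), (hy' ⟨hy, le_rfl⟩).2.2.le⟩, fun s hs => ?_⟩
      rcases le_or_gt s x with h2 | h2
      · exact hxS.2 s ⟨hs.1, h2⟩
      · have h3 : ‖f s - f x - 0 * ((g s - g x : ℝ) : 𝕜)‖ ≤ ε * (g s - g x) := (hy' ⟨h2, hs.2⟩).1
        rw [zero_mul, sub_zero] at h3
        calc ‖f s - f 0‖ = ‖(f s - f x) + (f x - f 0)‖ := by congr 1; ring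
          _ ≤ ‖f s - f x‖ + ‖f x - f 0‖ := norm_add_le _ _
          _ ≤ ε * (g s - g x) + ε * (g x - g 0) := add_le_add h3 hxx
          _ = ε * (g s - g 0) := by ring
    exact absurd (le_csSup hbd hyS) (not_le.2 hy)

/-- If `f` is constant on `[x, y]` and `g x < g y`, then the derivative vanishes at `x`. -/
lemma RegularOn.deriv_eq_zero (hg : RegularOn g T) (hh : GContinuousOn g 0 T h)
    (H : ∀ t ∈ Icc 0 T, HasGDerivAt g 0 T f (h t) t) {x y : ℝ} (hx : 0 ≤ x) (hy : y ≤ T)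
    (hf : ∀ s ∈ Icc x y, f s = f x) (hxy : g x < g y) : h x = 0 := by
  have hlt : x < y := lt_of_not_ge fun h => absurd (hg.monotone h) (not_le.2 hxy)
  -- `g` may be constant just to the right of `x`. At the top `d` of its level it is not, and `d <
  -- y` leaves room inside `[x, y]`.
  obtain ⟨d, hd, hgd, hgt⟩ := hg.exists_top (hlt.trans_le hy)
  have hdy : d < y := lt_of_not_ge fun h => absurd (hg.monotone h) (not_le.2 (hgd ▸ hxy))
  have hdT : d ∈ Icc 0 T := ⟨hx.trans hd.1, hd.2.le⟩
  rw [hh.eq_of_eq (s := x) (t := d) ⟨hx, hlt.le.trans hy⟩ hdT hgd.symm]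
  have hgt' : ∀ s, d < s → g d < g s := fun s hs => hgd ▸ hgt s hs
  have h1 := (hg.tendsto_quot H hdT (notMem_constSet_of_forall_lt hgt')).mono_left
    (nhdsWithin_Ioi_le_gFilter hdT.1 hd.2 hgt')
  refine tendsto_nhds_unique h1 (tendsto_const_nhds.congr' ?_)
  filter_upwards [Ioo_mem_nhdsGT hdy] with s hs
  rw [quot, hf s ⟨hd.1.trans hs.1.le, hs.2.le⟩, hf d ⟨hd.1, hdy.le⟩, sub_self, zero_div]

end GContinuous

/-! ### The Lebesgue–Stieltjes measure -/

/-- The Lebesgue–Stieltjes measure of a derivator. -/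
def IsDerivator.measure (hg : IsDerivator g) : Measure ℝ := hg.monotone.stieltjesFunction.measure

instance IsDerivator.isLocallyFiniteMeasure (hg : IsDerivator g) :
    IsLocallyFiniteMeasure hg.measure := by
  unfold IsDerivator.measure; infer_instance

/-- The Stieltjes function is the right-continuous version of `g`; its left limits recover `g`,
which is why `[a, b)` gets measure `g b - g a`. -/
lemma IsDerivator.leftLim_stieltjesFunction (hg : IsDerivator g) (t : ℝ) :
    Function.leftLim hg.monotone.stieltjesFunction t = g t := by
  have : (hg.monotone.stieltjesFunction : ℝ → ℝ) = Function.rightLim g :=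
    funext fun x => hg.monotone.stieltjesFunction_eq x
  rw [this, leftLim_rightLim (hg.monotone.tendsto_leftLim t), hg.leftLim_eq]

lemma IsDerivator.measure_Ico (hg : IsDerivator g) (a b : ℝ) :
    hg.measure (Ico a b) = ENNReal.ofReal (g b - g a) := by
  rw [IsDerivator.measure, StieltjesFunction.measure_Ico, hg.leftLim_stieltjesFunction,
    hg.leftLim_stieltjesFunction]

lemma IsDerivator.measure_singleton (hg : IsDerivator g) (a : ℝ) :
    hg.measure {a} = ENNReal.ofReal (jump g a) := by
  rw [IsDerivator.measure, StieltjesFunction.measure_singleton, hg.leftLim_stieltjesFunction,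
    Monotone.stieltjesFunction_eq, jump]

lemma IsDerivator.measureReal_Ico (hg : IsDerivator g) {a b : ℝ} (h : a ≤ b) :
    hg.measure.real (Ico a b) = g b - g a := by
  rw [Measure.real, hg.measure_Ico, ENNReal.toReal_ofReal (sub_nonneg.2 (hg.monotone h))]

lemma IsDerivator.measure_Ico_ne_top (hg : IsDerivator g) (a b : ℝ) :
    hg.measure (Ico a b) ≠ ⊤ := by
  rw [hg.measure_Ico]; exact ENNReal.ofReal_ne_top

lemma IsDerivator.measureReal_singleton (hg : IsDerivator g) (a : ℝ) :
    hg.measure.real {a} = jump g a := by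
  rw [Measure.real, hg.measure_singleton, ENNReal.toReal_ofReal (hg.jump_nonneg a)]

lemma IsDerivator.measureReal_Ioo (hg : IsDerivator g) {a b : ℝ} (h : a < b) :
    hg.measure.real (Ioo a b) = g b - g a - jump g a := by
  have h1 : hg.measure.real ({a} ∪ Ioo a b) = _ := measureReal_union (by simp) measurableSet_Ioo
    (by rw [hg.measure_singleton]; exact ENNReal.ofReal_ne_top)
    (measure_ne_top_of_subset Ioo_subset_Ico_self (hg.measure_Ico_ne_top a b))
  rw [singleton_union, Ioo_insert_left h, hg.measureReal_Ico h.le, hg.measureReal_singleton] at h1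
  linarith

lemma IsDerivator.countable_jumpSet (hg : IsDerivator g) : (jumpSet g).Countable := by
  refine Set.Countable.mono ?_ hg.monotone.countable_not_continuousAt
  intro t ht (hc : ContinuousAt g t)
  have := hc.tendsto.mono_left (nhdsWithin_le_nhds (s := Ioi t))
  have h2 := tendsto_nhds_unique this (hg.tendsto_Ioi t)
  have h3 : 0 < jump g t := ht
  linarith

lemma IsDerivator.measureReal_inter_jumpSet (hg : IsDerivator g) (a b : ℝ) :
    hg.measure.real (Ico a b ∩ jumpSet g) = ∑' s : ↥(Ico a b ∩ jumpSet g), jump g s := by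
  have hc : (Ico a b ∩ jumpSet g).Countable := hg.countable_jumpSet.mono inter_subset_right
  have h1 : hg.measure (Ico a b ∩ jumpSet g)
      = ∑' s : ↥(Ico a b ∩ jumpSet g), hg.measure {(s : ℝ)} := by
    conv_lhs => rw [← biUnion_of_singleton (Ico a b ∩ jumpSet g)]
    exact measure_biUnion hc (fun x _ y _ hxy => by simpa using hxy)
      fun x _ => measurableSet_singleton x
  rw [Measure.real, h1, ENNReal.tsum_toReal_eq fun s => by
    rw [hg.measure_singleton]; exact ENNReal.ofReal_ne_top]
  exact tsum_congr fun s => hg.measureReal_singleton s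

lemma IsDerivator.measurableSet_jumpSet (hg : IsDerivator g) : MeasurableSet (jumpSet g) :=
  hg.countable_jumpSet.measurableSet

/-! ### The continuous part `g^C` -/

section ContPart

lemma IsDerivator.jumpPart_eq (hg : IsDerivator g) {t : ℝ} (ht : 0 ≤ t) :
    jumpPart g 0 t = hg.measure.real (Ico 0 t ∩ jumpSet g) := by
  rcases ht.eq_or_lt with rfl | h
  · rw [hg.measureReal_inter_jumpSet]; simp [jumpPart]
  · rw [jumpPart, if_pos h, hg.measureReal_inter_jumpSet]

/-- On `[0, ∞)` the jump part measures the atoms, so `g^C` is the distribution function of `μ_g`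
restricted to the complement of `D_g`. -/
lemma IsDerivator.contPart_sub (hg : IsDerivator g) {s t : ℝ} (hs : 0 ≤ s) (hst : s ≤ t) :
    contPart g 0 t - contPart g 0 s = hg.measure.real (Ico s t \ jumpSet g) := by
  have h1 : hg.measure.real (Ico s t \ jumpSet g) + hg.measure.real (Ico s t ∩ jumpSet g)
      = hg.measure.real (Ico s t) :=
    measureReal_sdiff_add_inter hg.measurableSet_jumpSet (hg.measure_Ico_ne_top s t)
  have h2 : hg.measure.real (Ico 0 t ∩ jumpSet g)
      = hg.measure.real (Ico 0 s ∩ jumpSet g) + hg.measure.real (Ico s t ∩ jumpSet g) := by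
    rw [← measureReal_union (Ico_disjoint_Ico_same.mono inter_subset_left inter_subset_left)
      (measurableSet_Ico.inter hg.measurableSet_jumpSet)
      (measure_ne_top_of_subset inter_subset_left (hg.measure_Ico_ne_top 0 s))
      (measure_ne_top_of_subset inter_subset_left (hg.measure_Ico_ne_top s t)),
      ← union_inter_distrib_right, Ico_union_Ico_eq_Ico hs hst]
  rw [hg.measureReal_Ico hst] at h1
  rw [contPart, contPart, hg.jumpPart_eq hs, hg.jumpPart_eq (hs.trans hst)]
  linarith

lemma IsDerivator.contPart_mono (hg : IsDerivator g) {s t : ℝ} (hs : 0 ≤ s) (hst : s ≤ t) :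
    contPart g 0 s ≤ contPart g 0 t := by
  have := hg.contPart_sub hs hst
  have h2 : 0 ≤ hg.measure.real (Ico s t \ jumpSet g) := measureReal_nonneg
  linarith

lemma IsDerivator.contPart_sub_le (hg : IsDerivator g) {s t : ℝ} (hs : 0 ≤ s) (hst : s ≤ t) :
    contPart g 0 t - contPart g 0 s ≤ g t - g s := by
  rw [hg.contPart_sub hs hst, ← hg.measureReal_Ico hst]
  exact measureReal_mono sdiff_subset (hg.measure_Ico_ne_top s t)

/-- Discounting the atom at `s` makes the bound tend to `0` as `t` decreases to `s`; this yields
right continuity of `g^C` at jumps too. -/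
lemma IsDerivator.contPart_sub_le' (hg : IsDerivator g) {s t : ℝ} (hs : 0 ≤ s) (hst : s < t) :
    contPart g 0 t - contPart g 0 s ≤ g t - g s - jump g s := by
  by_cases hD : s ∈ jumpSet g
  · rw [hg.contPart_sub hs hst.le, ← hg.measureReal_Ioo hst]
    refine measureReal_mono ?_ (measure_ne_top_of_subset Ioo_subset_Ico_self
      (hg.measure_Ico_ne_top s t))
    rintro x ⟨hx, hxD⟩
    refine ⟨lt_of_le_of_ne hx.1 ?_, hx.2⟩
    rintro rfl
    exact hxD hD
  · rw [hg.jump_eq_zero hD, sub_zero]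
    exact hg.contPart_sub_le hs hst.le

lemma IsDerivator.contPart_tendsto_right (hg : IsDerivator g) {t : ℝ} (ht : 0 ≤ t) :
    Tendsto (contPart g 0) (𝓝[>] t) (𝓝 (contPart g 0 t)) := by
  have h1 : Tendsto (fun s => contPart g 0 t + (g s - g t - jump g t)) (𝓝[>] t)
      (𝓝 (contPart g 0 t)) := by
    have := (((hg.tendsto_Ioi t).sub_const (g t)).sub_const (jump g t)).const_add (contPart g 0 t)
    simpa using this
  refine tendsto_of_tendsto_of_tendsto_of_le_of_le' tendsto_const_nhds h1 ?_ ?_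
  · filter_upwards [self_mem_nhdsWithin] with s hs using hg.contPart_mono ht (le_of_lt hs)
  · filter_upwards [self_mem_nhdsWithin] with s hs
    have := hg.contPart_sub_le' ht hs
    linarith

lemma IsDerivator.contPart_tendsto_left (hg : IsDerivator g) {t : ℝ} (ht : 0 < t) :
    Tendsto (contPart g 0) (𝓝[<] t) (𝓝 (contPart g 0 t)) := by
  have h0 : Tendsto g (𝓝[<] t) (𝓝 (g t)) :=
    (hg.leftCts t).tendsto.mono_left (nhdsWithin_mono _ Iio_subset_Iic_self)
  have h1 : Tendsto (fun s => contPart g 0 t - (g t - g s)) (𝓝[<] t)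
      (𝓝 (contPart g 0 t)) := by
    have := (h0.const_sub (g t)).const_sub (contPart g 0 t)
    simpa using this
  refine tendsto_of_tendsto_of_tendsto_of_le_of_le' h1 tendsto_const_nhds ?_ ?_
  · filter_upwards [Ioo_mem_nhdsLT ht] with s hs
    have := hg.contPart_sub_le hs.1.le hs.2.le
    linarith
  · filter_upwards [Ioo_mem_nhdsLT ht] with s hs using hg.contPart_mono hs.1.le hs.2.le

lemma IsDerivator.jump_contPart (hg : IsDerivator g) {t : ℝ} (ht : 0 ≤ t) :
    t ∉ jumpSet (contPart g 0) := by
  have : jump (contPart g 0) t = 0 := by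
    rw [jump, rightLim_eq_of_tendsto (hg.contPart_tendsto_right ht), sub_self]
  simp [jumpSet, this]

lemma IsDerivator.contPart_tendsto (hg : IsDerivator g) {t : ℝ} (ht : 0 ≤ t) :
    Tendsto (contPart g 0) (𝓝[Icc 0 T] t) (𝓝 (contPart g 0 t)) := by
  have h1 : Tendsto (contPart g 0) (𝓝[Ici 0] t) (𝓝 (contPart g 0 t)) := by
    have h2 : ContinuousWithinAt (contPart g 0) (Ici t) t :=
      continuousWithinAt_Ioi_iff_Ici.1 (hg.contPart_tendsto_right ht)
    rcases ht.eq_or_lt with rfl | h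
    · exact h2
    · have h3 : ContinuousWithinAt (contPart g 0) (Iic t) t :=
        continuousWithinAt_Iio_iff_Iic.1 (hg.contPart_tendsto_left h)
      have h4 := h3.union h2
      rw [Iic_union_Ici] at h4
      exact h4.tendsto.mono_left (nhdsWithin_mono _ (subset_univ _))
  exact h1.mono_left (nhdsWithin_mono _ Icc_subset_Ici_self)

end ContPart

/-! ### Integration and the fundamental theorem of calculus -/

section Integral

variable {f h : ℝ → 𝕜}

/-- By continuity for the topology induced by `g`, preimages of open sets under `h` are preimages of
open sets under `g`, which are Borel because `g` is monotone. -/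
lemma IsDerivator.aestronglyMeasurable (hg : IsDerivator g) (hh : GContinuousOn g 0 T h)
    (μ : Measure ℝ) : AEStronglyMeasurable h (μ.restrict (Icc 0 T)) := by
  refine AEMeasurable.aestronglyMeasurable ?_
  refine aemeasurable_restrict_of_measurable_subtype measurableSet_Icc ?_
  have hgm : Measurable fun x : Icc (0 : ℝ) T => g x :=
    hg.monotone.measurable.comp measurable_subtype_coe
  refine measurable_of_isOpen fun U hU => ?_
  have hc : @Continuous _ _ (TopologicalSpace.induced (fun x : Icc (0 : ℝ) T => g x) inferInstance)
      _ (fun x : Icc (0 : ℝ) T => h x) := by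
    let : TopologicalSpace (Icc (0 : ℝ) T) :=
      TopologicalSpace.induced (fun x : Icc (0 : ℝ) T => g x) inferInstance
    refine continuous_iff_continuousAt.2 fun t => ?_
    rw [ContinuousAt, nhds_induced]
    have h1 := gContinuousOn_iff.1 hh t t.2
    have h2 : Tendsto (fun x : Icc (0 : ℝ) T => (x : ℝ)) (comap (fun x : Icc (0 : ℝ) T => g x)
        (𝓝 (g t))) (comap g (𝓝 (g t)) ⊓ 𝓟 (Icc 0 T)) := by
      refine tendsto_inf.2 ⟨tendsto_comap_iff.2 tendsto_comap, tendsto_principal.2 ?_⟩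
      exact Eventually.of_forall fun x => x.2
    exact h1.comp h2
  obtain ⟨V, hV, hVU⟩ := isOpen_induced_iff.1
    (@Continuous.isOpen_preimage _ _ (TopologicalSpace.induced _ _) _ _ hc U hU)
  rw [← hVU]
  exact hgm hV.measurableSet

lemma IsDerivator.integrableOn (hg : IsDerivator g) (hh : MemBC g 0 T 0 h) :
    IntegrableOn h (Ico 0 T) hg.measure := by
  obtain ⟨M, -, hM⟩ := hh.exists_bound
  have : IsFiniteMeasure (hg.measure.restrict (Ico 0 T)) :=
    isFiniteMeasure_restrict.2 (hg.measure_Ico_ne_top 0 T)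
  refine Integrable.of_bound ((hg.aestronglyMeasurable hh.1 hg.measure).mono_set
      Ico_subset_Icc_self)
    M ?_
  filter_upwards [ae_restrict_mem measurableSet_Ico] with x hx using hM x ⟨hx.1, hx.2.le⟩

/-- The integral `∫_{[0, t)} h dμ_g`. -/
def IsDerivator.int (hg : IsDerivator g) (h : ℝ → 𝕜) (t : ℝ) : 𝕜 :=
  ∫ x in Ico 0 t, h x ∂hg.measure

lemma IsDerivator.int_zero (hg : IsDerivator g) (h : ℝ → 𝕜) : hg.int h 0 = 0 := by
  simp [IsDerivator.int]

lemma IsDerivator.integrableOn_Ico (hg : IsDerivator g) (hh : MemBC g 0 T 0 h) {s t : ℝ}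
    (hs : 0 ≤ s) (ht : t ≤ T) : IntegrableOn h (Ico s t) hg.measure :=
  (hg.integrableOn hh).mono_set (Ico_subset_Ico hs ht)

lemma IsDerivator.int_sub_int (hg : IsDerivator g) (hh : MemBC g 0 T 0 h) {s t : ℝ} (hs : 0 ≤ s)
    (hst : s ≤ t) (ht : t ≤ T) : hg.int h t - hg.int h s = ∫ x in Ico s t, h x ∂hg.measure := by
  rw [IsDerivator.int, IsDerivator.int, ← Ico_union_Ico_eq_Ico hs hst, setIntegral_union
    Ico_disjoint_Ico_same measurableSet_Ico (hg.integrableOn_Ico hh le_rfl (hst.trans ht))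
    (hg.integrableOn_Ico hh hs ht)]
  ring

lemma IsDerivator.norm_setIntegral_sub_le (hg : IsDerivator g) {S : Set ℝ}
    (hSf : hg.measure S ≠ ⊤) (hh : IntegrableOn h S hg.measure) {x : 𝕜} {C : ℝ}
    (hx : ∀ r ∈ S, ‖h r - x‖ ≤ C) :
    ‖(∫ r in S, h r ∂hg.measure) - x * (hg.measure.real S : 𝕜)‖ ≤ C * hg.measure.real S := by
  have h1 : (∫ r in S, h r ∂hg.measure) - x * (hg.measure.real S : 𝕜)
      = ∫ r in S, (h r - x) ∂hg.measure := by
    rw [integral_sub hh (integrableOn_const hSf), setIntegral_const, RCLike.real_smul_eq_coe_mul,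
      mul_comm]
  rw [h1]
  exact norm_setIntegral_le_of_norm_le_const hSf.lt_top hx

lemma IsDerivator.norm_int_sub_le (hg : IsDerivator g) (hh : MemBC g 0 T 0 h) {s t : ℝ}
    (hs : 0 ≤ s) (hst : s ≤ t) (ht : t ≤ T) {x : 𝕜} {C : ℝ} (hx : ∀ r ∈ Ico s t, ‖h r - x‖ ≤ C) :
    ‖hg.int h t - hg.int h s - x * ((g t - g s : ℝ) : 𝕜)‖ ≤ C * (g t - g s) := by
  rw [hg.int_sub_int hh hs hst ht, ← hg.measureReal_Ico hst]
  exact hg.norm_setIntegral_sub_le (hg.measure_Ico_ne_top s t)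
    (hg.integrableOn_Ico hh hs ht) hx

/-- When `h` vanishes on `D_g` the atoms drop out, and the integral sees only the increments of
`g^C`. -/
lemma IsDerivator.norm_int_sub_contPart_le (hg : IsDerivator g) (hh : MemBC g 0 T 0 h) {s t : ℝ}
    (hs : 0 ≤ s) (hst : s ≤ t) (ht : t ≤ T) (h0 : ∀ r ∈ Ico s t, r ∈ jumpSet g → h r = 0)
    {x : 𝕜} {C : ℝ} (hx : ∀ r ∈ Ico s t, r ∉ jumpSet g → ‖h r - x‖ ≤ C) :
    ‖hg.int h t - hg.int h s - x * ((contPart g 0 t - contPart g 0 s : ℝ) : 𝕜)‖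
      ≤ C * (contPart g 0 t - contPart g 0 s) := by
  have hi := hg.integrableOn_Ico hh hs ht
  have h1 : ∫ r in Ico s t ∩ jumpSet g, h r ∂hg.measure = 0 :=
    setIntegral_eq_zero_of_forall_eq_zero fun r hr => h0 r hr.1 hr.2
  rw [hg.int_sub_int hh hs hst ht, hg.contPart_sub hs hst,
    ← integral_inter_add_sdiff hg.measurableSet_jumpSet hi, h1, zero_add]
  exact hg.norm_setIntegral_sub_le (measure_ne_top_of_subset sdiff_subset (hg.measure_Ico_ne_top s t)) (hi.mono_set sdiff_subset)
    fun r hr => hx r hr.1 hr.2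

lemma IsDerivator.norm_int_sub_int_le (hg : IsDerivator g) (hh : MemBC g 0 T 0 h) {M : ℝ}
    (hM : ∀ t ∈ Icc 0 T, ‖h t‖ ≤ M) :
    ∀ s ∈ Icc 0 T, ∀ t ∈ Icc 0 T, ‖hg.int h t - hg.int h s‖ ≤ M * |g t - g s| := by
  have key : ∀ s ∈ Icc 0 T, ∀ t ∈ Icc 0 T, s ≤ t →
      ‖hg.int h t - hg.int h s‖ ≤ M * |g t - g s| := by
    intro s hs t ht hst
    have := hg.norm_int_sub_le hh hs.1 hst ht.2 (x := 0) (C := M) fun r hr => by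
      rw [sub_zero]; exact hM r ⟨hs.1.trans hr.1, hr.2.le.trans ht.2⟩
    rw [zero_mul, sub_zero] at this
    rwa [abs_of_nonneg (sub_nonneg.2 (hg.monotone hst))]
  intro s hs t ht
  rcases le_total s t with hst | hst
  · exact key s hs t ht hst
  · rw [norm_sub_rev, abs_sub_comm]
    exact key t ht s hs hst

lemma IsDerivator.memBC_zero_int (hg : IsDerivator g) (hT : 0 ≤ T) (hh : MemBC g 0 T 0 h) :
    MemBC g 0 T 0 (hg.int h) := by
  obtain ⟨M, hM0, hM⟩ := hh.exists_bound
  have key := hg.norm_int_sub_int_le hh hM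
  refine ⟨gContinuousOn_of_lipschitz key, M * (g T - g 0), fun t ht => ?_⟩
  have h0 : (0 : ℝ) ∈ Icc 0 T := ⟨le_rfl, hT⟩
  have := key 0 h0 t ht
  rw [hg.int_zero, sub_zero, abs_of_nonneg (sub_nonneg.2 (hg.monotone ht.1))] at this
  exact this.trans (mul_le_mul_of_nonneg_left (sub_le_sub_right (hg.monotone ht.2) _) hM0)

/-- At a jump the atom contributes `h t * jump g t`, and the open interval after it has measure
tending to `0`. Elsewhere `g` is continuous at `t`, so `h` stays within `ε / 2` of `h t` between `s`
and `t`. -/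
lemma IsDerivator.tendsto_quot_int (hg : IsDerivator g) (hh : MemBC g 0 T 0 h) {t : ℝ}
    (ht : t ∈ Icc 0 T) : Tendsto (quot g (hg.int h) t) (gFilter g T t) (𝓝 (h t)) := by
  have hmem : ∀ᶠ s in gFilter g T t, s ∈ Icc 0 T := gFilter_le t self_mem_nhdsWithin
  by_cases hD : t ∈ jumpSet g
  · obtain ⟨M, hM0, hM⟩ := hh.exists_bound
    have hpos : 0 < jump g t := hD
    have hlim : Tendsto (hg.int h) (gFilter g T t) (𝓝 (hg.int h t + h t * (jump g t : 𝕜))) := by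
      rw [tendsto_iff_norm_sub_tendsto_zero]
      have hb : Tendsto (fun s => M * (g s - g t - jump g t)) (gFilter g T t) (𝓝 0) := by
        have := (((hg.tendsto_gFilter (T := T) t).sub_const (g t)).sub_const (jump g t)).const_mul M
        simpa using this
      refine tendsto_of_tendsto_of_tendsto_of_le_of_le' tendsto_const_nhds hb
        (Eventually.of_forall fun _ => norm_nonneg _) ?_
      have hgt : ∀ᶠ s in gFilter g T t, t < s := by
        rw [gFilter_of_mem hD]
        filter_upwards [self_mem_nhdsWithin] with s hs using hs.1
      filter_upwards [hmem, hgt] with s hs hts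
      have hi := hg.integrableOn_Ico hh ht.1 hs.2
      have h1 : hg.int h s - hg.int h t
          = h t * (jump g t : 𝕜) + ∫ r in Ioo t s, h r ∂hg.measure := by
        rw [hg.int_sub_int hh ht.1 hts.le hs.2, ← Ioo_insert_left hts, insert_eq,
          setIntegral_union (by simp) measurableSet_Ioo
            (hi.mono_set (by simpa using hts)) (hi.mono_set Ioo_subset_Ico_self),
          integral_singleton, hg.measureReal_singleton, RCLike.real_smul_eq_coe_mul, mul_comm]
      have h2 : hg.int h s - (hg.int h t + h t * (jump g t : 𝕜))
          = ∫ r in Ioo t s, h r ∂hg.measure := by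
        rw [← sub_sub, h1]; ring
      rw [h2, ← hg.measureReal_Ioo hts]
      exact norm_setIntegral_le_of_norm_le_const
        (measure_ne_top_of_subset Ioo_subset_Ico_self (hg.measure_Ico_ne_top t s)).lt_top
        fun r hr => hM r ⟨ht.1.trans hr.1.le, hr.2.le.trans hs.2⟩
    have hden : Tendsto (fun s => ((g s - g t : ℝ) : 𝕜)) (gFilter g T t) (𝓝 (jump g t : 𝕜)) := by
      have : Tendsto (fun s => g s - g t) (gFilter g T t) (𝓝 (jump g t)) := by
        simpa using (hg.tendsto_gFilter (T := T) t).sub_const (g t)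
      exact (RCLike.continuous_ofReal.tendsto _).comp this
    have hne : (jump g t : 𝕜) ≠ 0 := by exact_mod_cast hpos.ne'
    have := (hlim.sub_const (hg.int h t)).div hden hne
    rwa [add_sub_cancel_left, mul_div_cancel_right₀ _ hne] at this
  · rw [Metric.tendsto_nhds]
    intro ε hε
    obtain ⟨δ, hδ, hδh⟩ := hh.1 t ht (ε / 2) (by positivity)
    have hgt := hg.tendsto_gFilter (T := T) t
    rw [hg.jump_eq_zero hD, add_zero] at hgt
    filter_upwards [hmem, hg.eventually_ne t, Metric.tendsto_nhds.1 hgt δ hδ] with s hs hne hgs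
    rw [Real.dist_eq] at hgs
    have hb : ∀ r ∈ Icc 0 T, min s t ≤ r → r ≤ max s t → ‖h r - h t‖ ≤ ε / 2 := by
      intro r hr h1 h2
      rw [norm_sub_rev]
      refine (hδh r hr (lt_of_le_of_lt ?_ hgs)).le
      rcases le_total s t with hst | hst
      · rw [min_eq_left hst] at h1
        rw [max_eq_right hst] at h2
        have := hg.monotone h1
        have := hg.monotone h2
        rw [abs_of_nonneg (by linarith), abs_of_nonpos (by linarith)]
        linarith
      · rw [min_eq_right hst] at h1
        rw [max_eq_left hst] at h2
        have := hg.monotone h1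
        have := hg.monotone h2
        rw [abs_of_nonpos (by linarith), abs_of_nonneg (by linarith)]
        linarith
    have hest : ‖hg.int h s - hg.int h t - h t * ((g s - g t : ℝ) : 𝕜)‖ ≤ ε / 2 * |g s - g t| := by
      rcases le_total s t with hst | hst
      · have := hg.norm_int_sub_le hh hs.1 hst ht.2 (x := h t) (C := ε / 2) fun r hr =>
          hb r ⟨hs.1.trans hr.1, hr.2.le.trans ht.2⟩ (by simpa [hst] using hr.1)
            (by simpa [hst] using hr.2.le)
        rw [abs_of_nonpos (sub_nonpos.2 (hg.monotone hst)), neg_sub, ← norm_neg,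
          show -(hg.int h s - hg.int h t - h t * ((g s - g t : ℝ) : 𝕜))
            = hg.int h t - hg.int h s - h t * ((g t - g s : ℝ) : 𝕜) by push_cast; ring]
        exact this
      · have := hg.norm_int_sub_le hh ht.1 hst hs.2 (x := h t) (C := ε / 2) fun r hr =>
          hb r ⟨ht.1.trans hr.1, hr.2.le.trans hs.2⟩ (by simpa [hst] using hr.1)
            (by simpa [hst] using hr.2.le)
        rwa [abs_of_nonneg (sub_nonneg.2 (hg.monotone hst))]
    rw [← quot_mul_sub hne, ← sub_mul, norm_mul, RCLike.norm_ofReal] at hest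
    rw [dist_eq_norm]
    have := le_of_mul_le_mul_right hest (abs_pos.2 (sub_ne_zero.2 hne))
    linarith

lemma RegularOn.hasGDerivAt_int (hg : RegularOn g T) (hh : MemBC g 0 T 0 h) :
    ∀ t ∈ Icc 0 T, HasGDerivAt g 0 T (hg.toIsDerivator.int h) (h t) t :=
  hg.hasGDerivAt_of_notMem_constSet hh.1 fun _ ht _ => hg.tendsto_quot_int hh ht

lemma RegularOn.hasGDerivAt_add (hg : RegularOn g T) {f₁ f₂ h₁ h₂ : ℝ → 𝕜}
    (H₁ : ∀ t ∈ Icc 0 T, HasGDerivAt g 0 T f₁ (h₁ t) t) (hh₁ : MemBC g 0 T 0 h₁)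
    (H₂ : ∀ t ∈ Icc 0 T, HasGDerivAt g 0 T f₂ (h₂ t) t) (hh₂ : MemBC g 0 T 0 h₂) :
    ∀ t ∈ Icc 0 T, HasGDerivAt g 0 T (fun t => f₁ t + f₂ t) (h₁ t + h₂ t) t :=
  hg.hasGDerivAt_of_notMem_constSet (hh₁.add_zero hh₂).1 fun t ht hC => by
    refine ((hg.tendsto_quot H₁ ht hC).add (hg.tendsto_quot H₂ ht hC)).congr fun s => ?_
    unfold quot; ring

lemma RegularOn.hasGDerivAt_const_mul (hg : RegularOn g T) {f₁ h₁ : ℝ → 𝕜} (c : 𝕜)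
    (H₁ : ∀ t ∈ Icc 0 T, HasGDerivAt g 0 T f₁ (h₁ t) t) (hh₁ : MemBC g 0 T 0 h₁) :
    ∀ t ∈ Icc 0 T, HasGDerivAt g 0 T (fun t => c * f₁ t) (c * h₁ t) t :=
  hg.hasGDerivAt_of_notMem_constSet ((memBC_zero_const c).mul_zero hh₁).1 fun t ht hC => by
    refine ((hg.tendsto_quot H₁ ht hC).const_mul c).congr fun s => ?_
    unfold quot; ring

/-- The fundamental theorem of calculus for the `g`-derivative. -/
lemma RegularOn.eq_add_int (hg : RegularOn g T) (hf : MemBC g 0 T 0 f) (hh : MemBC g 0 T 0 h)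
    (H : ∀ t ∈ Icc 0 T, HasGDerivAt g 0 T f (h t) t) {t : ℝ} (ht : t ∈ Icc 0 T) :
    f t = f 0 + hg.toIsDerivator.int h t := by
  have hi := hg.toIsDerivator.memBC_zero_int hg.pos.le hh
  have h1 := hg.hasGDerivAt_add H hh (hg.hasGDerivAt_const_mul (-1) (hg.hasGDerivAt_int hh) hh)
    ((memBC_zero_const _).mul_zero hh)
  have h2 := hg.eq_of_deriv_zero (hf.add_zero ((memBC_zero_const (-1)).mul_zero hi)).1
    (fun t ht => by simpa using h1 t ht) ht
  rw [hg.toIsDerivator.int_zero] at h2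
  linear_combination h2

end Integral

/-! ### Factorial bounds for iterated integrals -/

section Iterated

open scoped ENNReal Nat

/-- The iterated integrals of `1` over `0 ≤ s₁ < ⋯ < sₙ < t`. -/
def iterInt (μ : Measure ℝ) : ℕ → ℝ → ℝ≥0∞
  | 0, _ => 1
  | n + 1, t => ∫⁻ s in Ico 0 t, iterInt μ n s ∂μ

lemma measurable_iterInt (μ : Measure ℝ) (n : ℕ) : Measurable (iterInt μ n) := by
  cases n with
  | zero => exact measurable_const
  | succ n =>
    exact Monotone.measurable fun s t hst => lintegral_mono_set (Ico_subset_Ico_right hst)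

/-- Cut `[0, t)` at `s`: `I_{n+1}(s)` plus the integral of `I_n` over `(s, t)` is at most
`I_{n+1}(t)`, the atom at `s` being dropped. Integrating in `s` and exchanging the order turns the
second term into `∫ μ[0, r) I_n(r)`, which by induction is at least `(n + 1) I_{n+2}(t)`. -/
lemma succ_mul_iterInt_le (μ : Measure ℝ) [SFinite μ] (n : ℕ) (t : ℝ) :
    (n + 1 : ℝ≥0∞) * iterInt μ (n + 1) t ≤ μ (Ico 0 t) * iterInt μ n t := by
  induction n generalizing t with
  | zero => simp [iterInt]
  | succ n ih =>
    have hm := measurable_iterInt μ n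
    have hF : Measurable (Function.uncurry fun s r : ℝ =>
        (Ioi s).indicator (iterInt μ n) r) := by
      have : (Function.uncurry fun s r : ℝ => (Ioi s).indicator (iterInt μ n) r)
          = {p : ℝ × ℝ | p.1 < p.2}.indicator (fun p => iterInt μ n p.2) := by
        ext p; simp [Function.uncurry, indicator]
      rw [this]
      exact (hm.comp measurable_snd).indicator (measurableSet_lt measurable_fst measurable_snd)
    have h1 : ∀ s ∈ Ico 0 t, iterInt μ (n + 1) s
        + ∫⁻ r in Ico 0 t, (Ioi s).indicator (iterInt μ n) r ∂μ ≤ iterInt μ (n + 1) t := by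
      intro s hs
      rw [lintegral_indicator measurableSet_Ioi, Measure.restrict_restrict measurableSet_Ioi,
        iterInt, iterInt]
      rw [← lintegral_union (measurableSet_Ioi.inter measurableSet_Ico)]
      · refine lintegral_mono_set (union_subset (Ico_subset_Ico_right hs.2.le) inter_subset_right)
      · rw [Set.disjoint_left]
        intro x hx hx'
        exact absurd hx'.1 (not_lt.2 hx.2.le)
    have h2 : ∫⁻ s in Ico 0 t, ∫⁻ r in Ico 0 t, (Ioi s).indicator (iterInt μ n) r ∂μ ∂μ
        = ∫⁻ r in Ico 0 t, μ (Ico 0 r) * iterInt μ n r ∂μ := by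
      rw [lintegral_lintegral_swap hF.aemeasurable]
      refine setLIntegral_congr_fun measurableSet_Ico fun r hr => ?_
      have : ∀ s, (Ioi s).indicator (iterInt μ n) r
          = (Iio r).indicator (fun _ => iterInt μ n r) s := fun s => by simp [indicator]
      simp_rw [this]
      rw [lintegral_indicator measurableSet_Iio, Measure.restrict_restrict measurableSet_Iio,
        setLIntegral_const, mul_comm]
      congr 2
      ext x
      simp only [mem_inter_iff, mem_Iio, mem_Ico]
      exact ⟨fun h => ⟨h.2.1, h.1⟩, fun h => ⟨h.2, h.1, h.2.trans hr.2⟩⟩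
    calc ((n + 1 : ℕ) + 1 : ℝ≥0∞) * iterInt μ (n + 2) t
        = iterInt μ (n + 2) t + ∫⁻ r in Ico 0 t, (n + 1 : ℝ≥0∞) * iterInt μ (n + 1) r ∂μ := by
          rw [lintegral_const_mul _ (measurable_iterInt μ _)]
          change _ = iterInt μ (n + 2) t + _ * iterInt μ (n + 2) t
          push_cast; ring
      _ ≤ iterInt μ (n + 2) t + ∫⁻ r in Ico 0 t, μ (Ico 0 r) * iterInt μ n r ∂μ :=
          add_le_add le_rfl (lintegral_mono fun r => ih r)
      _ = ∫⁻ s in Ico 0 t, (iterInt μ (n + 1) s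
            + ∫⁻ r in Ico 0 t, (Ioi s).indicator (iterInt μ n) r ∂μ) ∂μ := by
          rw [lintegral_add_left (measurable_iterInt μ _), h2]; rfl
      _ ≤ ∫⁻ _ in Ico 0 t, iterInt μ (n + 1) t ∂μ := setLIntegral_mono measurable_const h1
      _ = μ (Ico 0 t) * iterInt μ (n + 1) t := by rw [setLIntegral_const, mul_comm]

lemma factorial_mul_iterInt_le (μ : Measure ℝ) [SFinite μ] (n : ℕ) (t : ℝ) :
    (n ! : ℝ≥0∞) * iterInt μ n t ≤ μ (Ico 0 t) ^ n := by
  induction n with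
  | zero => simp [iterInt]
  | succ n ih =>
    calc ((n + 1)! : ℝ≥0∞) * iterInt μ (n + 1) t
        = n ! * ((n + 1 : ℝ≥0∞) * iterInt μ (n + 1) t) := by
          rw [Nat.factorial_succ]; push_cast; ring
      _ ≤ n ! * (μ (Ico 0 t) * iterInt μ n t) :=
          mul_le_mul_right (succ_mul_iterInt_le μ n t) _
      _ = μ (Ico 0 t) * (n ! * iterInt μ n t) := by ring
      _ ≤ μ (Ico 0 t) * μ (Ico 0 t) ^ n := by gcongr
      _ = μ (Ico 0 t) ^ (n + 1) := by rw [pow_succ']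

lemma IsDerivator.iterInt_le (hg : IsDerivator g) (n : ℕ) {t : ℝ} (h0 : 0 ≤ t) (ht : t ≤ T) :
    iterInt hg.measure n t ≤ ENNReal.ofReal ((g T - g 0) ^ n / n !) := by
  have hpos : (0 : ℝ) < n ! := by positivity
  rw [ENNReal.ofReal_div_of_pos hpos, ENNReal.ofReal_natCast, ENNReal.le_div_iff_mul_le
    (Or.inl (by positivity)) (Or.inl (ENNReal.natCast_ne_top _)), mul_comm,
    ENNReal.ofReal_pow (sub_nonneg.2 (hg.monotone (h0.trans ht)))]
  refine (factorial_mul_iterInt_le hg.measure n t).trans ?_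
  rw [hg.measure_Ico]
  gcongr
  exact hg.monotone ht

end Iterated

/-! ### The linear problem in `BC_g^0`: Picard series and uniqueness -/

section Linear

open scoped ENNReal Nat

variable {β f : ℝ → 𝕜}

lemma IsDerivator.enorm_int_mul_le (hg : IsDerivator g) {w : ℝ → 𝕜} {M : ℝ} {A : ℝ≥0∞}
    (hM : ∀ t ∈ Icc 0 T, ‖β t‖ ≤ M) (n : ℕ)
    (hw : ∀ t ∈ Icc 0 T, ‖w t‖ₑ ≤ A * iterInt hg.measure n t) :
    ∀ t ∈ Icc 0 T, ‖hg.int (fun s => β s * w s) t‖ₑ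
      ≤ ENNReal.ofReal M * A * iterInt hg.measure (n + 1) t := by
  intro t ht
  refine (enorm_integral_le_lintegral_enorm _).trans ?_
  rw [iterInt, ← lintegral_const_mul _ (measurable_iterInt _ n)]
  refine setLIntegral_mono ((measurable_iterInt _ n).const_mul _) fun s hs => ?_
  have hs' : s ∈ Icc 0 T := ⟨hs.1, hs.2.le.trans ht.2⟩
  rw [enorm_mul, mul_assoc]
  gcongr
  · rw [← ofReal_norm]
    exact ENNReal.ofReal_le_ofReal (hM s hs')
  · exact hw s hs'

/-- The terms of the Picard series. -/
def IsDerivator.picard (hg : IsDerivator g) (β u₀ : ℝ → 𝕜) : ℕ → ℝ → 𝕜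
  | 0 => u₀
  | n + 1 => hg.int fun s => β s * hg.picard β u₀ n s

lemma IsDerivator.memBC_picard (hg : IsDerivator g) (hT : 0 ≤ T) {u₀ : ℝ → 𝕜}
    (hβ : MemBC g 0 T 0 β) (hu : MemBC g 0 T 0 u₀) (n : ℕ) :
    MemBC g 0 T 0 (hg.picard β u₀ n) := by
  induction n with
  | zero => exact hu
  | succ n ih => exact hg.memBC_zero_int hT (hβ.mul_zero ih)

lemma IsDerivator.norm_picard_le (hg : IsDerivator g) (hT : 0 ≤ T) {u₀ : ℝ → 𝕜} {M C : ℝ}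
    (hM0 : 0 ≤ M) (hC0 : 0 ≤ C)
    (hM : ∀ t ∈ Icc 0 T, ‖β t‖ ≤ M) (hC : ∀ t ∈ Icc 0 T, ‖u₀ t‖ ≤ C) (n : ℕ) :
    ∀ t ∈ Icc 0 T, ‖hg.picard β u₀ n t‖ ≤ C * ((M * (g T - g 0)) ^ n / n !) := by
  have key : ∀ n : ℕ, ∀ t ∈ Icc 0 T, ‖hg.picard β u₀ n t‖ₑ
      ≤ ENNReal.ofReal M ^ n * ENNReal.ofReal C * iterInt hg.measure n t := by
    intro n
    induction n with
    | zero =>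
      intro t ht
      simp only [IsDerivator.picard, iterInt, pow_zero, one_mul, mul_one]
      rw [← ofReal_norm]
      exact ENNReal.ofReal_le_ofReal (hC t ht)
    | succ n ih =>
      intro t ht
      refine (hg.enorm_int_mul_le hM n ih t ht).trans_eq ?_
      rw [pow_succ]; ring
  intro t ht
  have hm : 0 ≤ g T - g 0 := sub_nonneg.2 (hg.monotone hT)
  have h1 := (key n t ht).trans (mul_le_mul_right (hg.iterInt_le n ht.1 ht.2) _)
  rw [← ENNReal.ofReal_pow hM0, ← ENNReal.ofReal_mul (by positivity),
    ← ENNReal.ofReal_mul (by positivity), ← ofReal_norm,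
    ENNReal.ofReal_le_ofReal_iff (by positivity)] at h1
  refine h1.trans_eq ?_
  rw [mul_pow]; ring

lemma summable_picard_bound (C x : ℝ) : Summable fun n : ℕ => C * (x ^ n / n !) :=
  (Real.summable_pow_div_factorial x).mul_left C

/-- The Picard series starting from `v₀ + ∫ f` has a summable majorant. Its sum is `g`-continuous as
a uniform limit, and dominated convergence makes it a solution of the integral equation. -/
lemma RegularOn.exists_solution (hg : RegularOn g T) (hβ : MemBC g 0 T 0 β)
    (hf : MemBC g 0 T 0 f) (v₀ : 𝕜) :
    ∃ v : ℝ → 𝕜, MemBC g 0 T 0 v ∧ IsSolution g T (fun t x => β t * x + f t) v₀ v := by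
  have hd := hg.toIsDerivator
  obtain ⟨M, hM0, hM⟩ := hβ.exists_bound
  set u₀ : ℝ → 𝕜 := fun t => v₀ + hd.int f t with hu₀
  have hu : MemBC g 0 T 0 u₀ := (memBC_zero_const v₀).add_zero (hd.memBC_zero_int hg.pos.le hf)
  obtain ⟨C, hC0, hC⟩ := hu.exists_bound
  set b : ℕ → ℝ := fun n => C * ((M * (g T - g 0)) ^ n / n !) with hb
  have hbs : Summable b := summable_picard_bound _ _
  set u := hd.picard β u₀ with hu_def
  have hub : ∀ n, ∀ t ∈ Icc 0 T, ‖u n t‖ ≤ b n := hd.norm_picard_le hg.pos.le hM0 hC0 hM hC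
  have huBC : ∀ n, MemBC g 0 T 0 (u n) := hd.memBC_picard hg.pos.le hβ hu
  set v : ℝ → 𝕜 := fun t => ∑' n, u n t with hv
  have hsum : ∀ t ∈ Icc 0 T, HasSum (fun n => u n t) (v t) := fun t ht =>
    (Summable.of_norm_bounded hbs fun n => hub n t ht).hasSum
  have hvB : ∀ t ∈ Icc 0 T, ‖v t‖ ≤ ∑' n, b n := fun t ht =>
    tsum_of_norm_bounded hbs.hasSum fun n => hub n t ht
  have hvG : GContinuousOn g 0 T v := by
    intro t ht ε hε
    obtain ⟨N, hN⟩ : ∃ N, ∑' n, b (n + N) < ε / 3 :=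
      ((tendsto_order.1 (tendsto_sum_nat_add b)).2 (ε / 3) (by positivity)).exists
    have htail : ∀ s ∈ Icc 0 T, ‖v s - ∑ n ∈ Finset.range N, u n s‖ < ε / 3 := by
      intro s hs
      have h1 : v s - ∑ n ∈ Finset.range N, u n s = ∑' n, u (n + N) s := by
        rw [(hsum s hs).tsum_eq.symm, ← (hsum s hs).summable.sum_add_tsum_nat_add N]; ring
      rw [h1]
      exact (tsum_of_norm_bounded ((summable_nat_add_iff N).2 hbs).hasSum
        fun n => hub (n + N) s hs).trans_lt hN
    have hpart : GContinuousOn g 0 T fun s => ∑ n ∈ Finset.range N, u n s :=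
      gContinuousOn_iff.2 fun s hs => tendsto_finsetSum _ fun n _ =>
        gContinuousOn_iff.1 (huBC n).1 s hs
    obtain ⟨δ, hδ, h⟩ := hpart t ht (ε / 3) (by positivity)
    refine ⟨δ, hδ, fun s hs hst => ?_⟩
    have h1 := htail t ht
    have h2 := htail s hs
    have h3 := h s hs hst
    have h4 : v t - v s = (v t - ∑ n ∈ Finset.range N, u n t)
        + (∑ n ∈ Finset.range N, u n t - ∑ n ∈ Finset.range N, u n s)
        - (v s - ∑ n ∈ Finset.range N, u n s) := by ring
    rw [h4]
    refine (norm_sub_le _ _).trans_lt ?_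
    have h5 := norm_add_le (v t - ∑ n ∈ Finset.range N, u n t)
      (∑ n ∈ Finset.range N, u n t - ∑ n ∈ Finset.range N, u n s)
    linarith
  have hvBC : MemBC g 0 T 0 v := ⟨hvG, _, hvB⟩
  have hβv := hβ.mul_zero hvBC
  have hfix : ∀ t ∈ Icc 0 T, v t = v₀ + hd.int (fun s => β s * v s + f s) t := by
    intro t ht
    have hi1 := hd.integrableOn_Ico hβv le_rfl ht.2
    have hi2 := hd.integrableOn_Ico hf le_rfl ht.2
    have h1 : hd.int (fun s => β s * v s + f s) t = hd.int (fun s => β s * v s) t + hd.int f t :=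
      integral_add hi1 hi2
    have h2 : HasSum (fun n => u (n + 1) t) (hd.int (fun s => β s * v s) t) := by
      have : IsFiniteMeasure (hd.measure.restrict (Ico 0 t)) :=
        isFiniteMeasure_restrict.2 (hd.measure_Ico_ne_top 0 t)
      have hmem : ∀ᵐ s ∂hd.measure.restrict (Ico 0 t), s ∈ Icc 0 T := by
        filter_upwards [ae_restrict_mem measurableSet_Ico] with s hs
          using ⟨hs.1, hs.2.le.trans ht.2⟩
      refine hasSum_integral_of_dominated_convergence (fun n _ => M * b n)
        (fun n => (hd.integrableOn_Ico (hβ.mul_zero (huBC n)) le_rfl ht.2).aestronglyMeasurable)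
        (fun n => ?_) (ae_of_all _ fun _ => hbs.mul_left M) (integrable_const _) ?_
      · filter_upwards [hmem] with s hs
        rw [norm_mul]
        exact mul_le_mul (hM s hs) (hub n s hs) (norm_nonneg _) hM0
      · filter_upwards [hmem] with s hs using (hsum s hs).mul_left _
    -- The series without its term `u 0` sums to `v t - u 0 t`, and also to the integral of `β v`.
    have h3 := (hasSum_nat_add_iff' 1).2 (hsum t ht)
    have h4 := h3.unique h2
    rw [Finset.sum_range_one] at h4
    have h5 : u 0 t = v₀ + hd.int f t := rfl
    rw [h1, ← h4, h5]; ring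
  have hF : MemBC g 0 T 0 fun s => β s * v s + f s := hβv.add_zero hf
  refine ⟨v, hvBC, ?_, ?_⟩
  · rw [hfix 0 ⟨le_rfl, hg.pos.le⟩, hd.int_zero, add_zero]
  · refine hg.hasGDerivAt_of_notMem_constSet hF.1 fun t ht hC => ?_
    refine (hd.tendsto_quot_int hF ht).congr' ?_
    filter_upwards [gFilter_le t self_mem_nhdsWithin] with s hs
    rw [quot, quot, hfix s hs, hfix t ht]
    congr 1; ring

/-- The difference `z` of two solutions is fixed by `z ↦ ∫ β z`, hence equals each of its Picard
iterates, and their bounds tend to `0`. -/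
lemma RegularOn.solution_unique (hg : RegularOn g T) (hβ : MemBC g 0 T 0 β)
    (hf : MemBC g 0 T 0 f) {v₀ : 𝕜} {v w : ℝ → 𝕜} (hv : MemBC g 0 T 0 v) (hw : MemBC g 0 T 0 w)
    (hvs : IsSolution g T (fun t x => β t * x + f t) v₀ v)
    (hws : IsSolution g T (fun t x => β t * x + f t) v₀ w) : EqOn w v (Icc 0 T) := by
  have hd := hg.toIsDerivator
  obtain ⟨M, hM0, hM⟩ := hβ.exists_bound
  set z : ℝ → 𝕜 := fun t => w t + (-1) * v t with hz_def
  have hz : MemBC g 0 T 0 z := hw.add_zero ((memBC_zero_const (-1)).mul_zero hv)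
  obtain ⟨C, hC0, hC⟩ := hz.exists_bound
  have hFv := (hβ.mul_zero hv).add_zero hf
  have hFw := (hβ.mul_zero hw).add_zero hf
  have hzint : ∀ t ∈ Icc 0 T, z t = hd.int (fun s => β s * z s) t := by
    intro t ht
    have h1 := hg.hasGDerivAt_add hws.2 hFw (hg.hasGDerivAt_const_mul (-1) hvs.2 hFv)
      ((memBC_zero_const (-1)).mul_zero hFv)
    have h2 := hg.eq_add_int hz (hβ.mul_zero hz) (fun t ht => by
      have := h1 t ht
      rwa [show β t * w t + f t + (-1) * (β t * v t + f t) = β t * z t by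
        rw [hz_def]; ring] at this) ht
    rw [h2, hz_def]
    simp [hvs.1, hws.1]
  have hbound : ∀ n, ∀ t ∈ Icc 0 T, ‖z t‖ ≤ C * ((M * (g T - g 0)) ^ n / n !) := by
    intro n t ht
    have h1 : ∀ n, ∀ t ∈ Icc 0 T, hd.picard β z n t = z t := by
      intro n
      induction n with
      | zero => intro t _; rfl
      | succ n ih =>
        intro t ht
        rw [hzint t ht]
        refine setIntegral_congr_fun measurableSet_Ico fun s hs => ?_
        rw [ih s ⟨hs.1, hs.2.le.trans ht.2⟩]
    rw [← h1 n t ht]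
    exact hd.norm_picard_le hg.pos.le hM0 hC0 hM hC n t ht
  intro t ht
  have h1 : ‖z t‖ ≤ 0 := ge_of_tendsto (summable_picard_bound C (M * (g T - g 0))).tendsto_atTop_zero
    (Eventually.of_forall fun n => hbound n t ht)
  have h2 := norm_le_zero_iff.1 h1
  rw [hz_def] at h2
  linear_combination h2

end Linear

/-! ### Multipliers of `BC_g^n` and the bootstrap -/

section Multiplier

variable {f h v : ℝ → 𝕜}

lemma MemBC.of_succ {a b : ℝ} {n : ℕ} {f : ℝ → 𝕜} (hf : MemBC g a b (n + 1) f) :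
    MemBC g a b n f := by
  induction n generalizing f with
  | zero => exact hf.toZero
  | succ n ih =>
    obtain ⟨h0, h, hd, hh⟩ := hf
    exact ⟨h0, h, hd, ih hh⟩

lemma MemBC.mono {a b : ℝ} {m n : ℕ} (hmn : m ≤ n) (hf : MemBC g a b n f) : MemBC g a b m f := by
  induction hmn with
  | refl => exact hf
  | step _ ih => exact ih hf.of_succ

lemma RegularOn.memBC_add (hg : RegularOn g T) {n : ℕ} {f h : ℝ → 𝕜} (hf : MemBC g 0 T n f)
    (hh : MemBC g 0 T n h) : MemBC g 0 T n (fun t => f t + h t) := by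
  induction n generalizing f h with
  | zero => exact hf.add_zero hh
  | succ n ih =>
    obtain ⟨f0, f', hf', hf''⟩ := hf
    obtain ⟨h0, h', hh', hh''⟩ := hh
    exact ⟨MemBC.add_zero f0 h0, _, hg.hasGDerivAt_add hf' hf''.toZero hh' hh''.toZero,
      ih hf'' hh''⟩

lemma RegularOn.memBC_const_mul (hg : RegularOn g T) {n : ℕ} (c : 𝕜) {f : ℝ → 𝕜}
    (hf : MemBC g 0 T n f) : MemBC g 0 T n (fun t => c * f t) := by
  induction n generalizing f with
  | zero => exact (memBC_zero_const c).mul_zero hf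
  | succ n ih =>
    obtain ⟨f0, f', hf', hf''⟩ := hf
    exact ⟨(memBC_zero_const c).mul_zero f0, _, hg.hasGDerivAt_const_mul c hf' hf''.toZero, ih hf''⟩

/-- Functions by which `BC_g^n` can be multiplied: the product rule
`(f v)' = f' v + f v' + (f' Δ⁺g) v'` stays in the class at every order. -/
def GoodMul (g : ℝ → ℝ) (T : ℝ) : ℕ → (ℝ → 𝕜) → Prop
  | 0, f => MemBC g 0 T 0 f
  | n + 1, f => MemBC g 0 T 0 f ∧ ∃ h : ℝ → 𝕜, (∀ t ∈ Icc 0 T, HasGDerivAt g 0 T f (h t) t) ∧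
      GoodMul g T n h ∧ ∃ w : ℝ → 𝕜, GoodMul g T n w ∧
        -- On `C_g` the jump is `0`, but a `g`-continuous `w` must keep along a level the value it
        -- has at a jump ending that level. Hence the restriction to points off `C_g`.
        ∀ t ∈ Icc 0 T, t ∉ constSet g → w t = h t * (jump g t : 𝕜)

lemma GoodMul.toZero {n : ℕ} (hf : GoodMul g T n f) : MemBC g 0 T 0 f := by
  cases n with
  | zero => exact hf
  | succ n => exact hf.1

lemma GoodMul.of_succ {n : ℕ} {f : ℝ → 𝕜} (hf : GoodMul g T (n + 1) f) : GoodMul g T n f := by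
  induction n generalizing f with
  | zero => exact hf.1
  | succ n ih =>
    obtain ⟨h0, h, hd, hh, w, hw, hwj⟩ := hf
    exact ⟨h0, h, hd, ih hh, w, ih hw, hwj⟩

lemma GoodMul.mono {m n : ℕ} (hmn : m ≤ n) (hf : GoodMul g T n f) : GoodMul g T m f := by
  induction hmn with
  | refl => exact hf
  | step _ ih => exact ih hf.of_succ

lemma RegularOn.goodMul_zero (hg : RegularOn g T) (n : ℕ) :
    GoodMul g T n (fun _ => (0 : 𝕜)) := by
  induction n with
  | zero => exact memBC_zero_const 0
  | succ n ih =>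
    refine ⟨memBC_zero_const 0, fun _ => 0, ?_, ih, fun _ => 0, ih, fun _ _ _ => by simp⟩
    refine hg.hasGDerivAt_of_notMem_constSet (memBC_zero_const 0).1 fun t _ _ => ?_
    exact tendsto_const_nhds.congr fun s => by simp [quot]

/-- The product rule. -/
lemma RegularOn.tendsto_quot_mul (hg : RegularOn g T) {f' v' : 𝕜} {t : ℝ}
    (hf : Tendsto (quot g f t) (gFilter g T t) (𝓝 f'))
    (hv : Tendsto (quot g v t) (gFilter g T t) (𝓝 v')) :
    Tendsto (quot g (fun s => f s * v s) t) (gFilter g T t)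
      (𝓝 (f' * v t + f t * v' + f' * (jump g t : 𝕜) * v')) := by
  have h1 := (hf.mul (hg.toIsDerivator.tendsto_of_quot hv)).add (hv.const_mul (f t))
  rw [show f' * v t + f t * v' + f' * (jump g t : 𝕜) * v'
    = f' * (v t + v' * (jump g t : 𝕜)) + f t * v' by ring]
  refine h1.congr fun s => ?_
  unfold quot; ring

lemma GoodMul.mul (hg : RegularOn g T) {n : ℕ} {f v : ℝ → 𝕜} (hf : GoodMul g T n f)
    (hv : MemBC g 0 T n v) : MemBC g 0 T n (fun t => f t * v t) := by
  induction n generalizing f v with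
  | zero => exact MemBC.mul_zero hf hv
  | succ n ih =>
    have hf1 := hf.of_succ
    have hv1 := hv.of_succ
    obtain ⟨f0, f', hf', hf'', w, hw, hwj⟩ := hf
    obtain ⟨v0, v', hv', hv''⟩ := hv
    have hder : MemBC g 0 T n (fun t => f' t * v t + f t * v' t + w t * v' t) :=
      hg.memBC_add (hg.memBC_add (ih hf'' hv1) (ih hf1 hv'')) (ih hw hv'')
    refine ⟨MemBC.mul_zero f0 v0, _, ?_, hder⟩
    refine hg.hasGDerivAt_of_notMem_constSet hder.toZero.1 fun t ht hC => ?_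
    rw [hwj t ht hC]
    exact hg.tendsto_quot_mul (hg.tendsto_quot hf' ht hC) (hg.tendsto_quot hv' ht hC)

lemma RegularOn.hasUniqueSolutionInBC (hg : RegularOn g T) {n : ℕ} {β f : ℝ → 𝕜} (v₀ : 𝕜)
    (hβ : GoodMul g T n β) (hf : MemBC g 0 T n f) :
    HasUniqueSolutionInBC g T (n + 1) (fun t x => β t * x + f t) v₀ := by
  obtain ⟨v, hv, hvs⟩ := hg.exists_solution hβ.toZero hf.toZero v₀
  -- Bootstrap: if `v` is in `BC_g^{j+1}`, so is `β v + f`, which is the derivative of `v`.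
  have hreg : ∀ j ≤ n, MemBC g 0 T (j + 1) v := by
    intro j
    induction j with
    | zero => exact fun _ => ⟨hv, _, hvs.2, (hβ.toZero.mul_zero hv).add_zero hf.toZero⟩
    | succ j ih =>
      intro hj
      exact ⟨hv, _, hvs.2, hg.memBC_add ((hβ.mono hj).mul hg (ih (by omega))) (hf.mono hj)⟩
  exact ⟨v, ⟨hreg n le_rfl, hvs⟩, fun w hw =>
    hg.solution_unique hβ.toZero hf.toZero hv hw.1.toZero hvs hw.2⟩

end Multiplier

lemma GoodMul.memBC {n : ℕ} {f : ℝ → 𝕜} (hf : GoodMul g T n f) : MemBC g 0 T n f := by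
  induction n generalizing f with
  | zero => exact hf
  | succ n ih =>
    obtain ⟨h0, h, hd, hh, -⟩ := hf
    exact ⟨h0, h, hd, ih hh⟩

/-! ### Indicators of levels that end with a jump -/

section Level

/-- The indicator function of the level set of `g` through `b`. -/
def levelInd (𝕜 : Type*) [RCLike 𝕜] (g : ℝ → ℝ) (b t : ℝ) : 𝕜 :=
  open Classical in if g t = g b then 1 else 0

lemma levelInd_of_eq {b t : ℝ} (h : g t = g b) : levelInd 𝕜 g b t = 1 := if_pos h

lemma levelInd_of_ne {b t : ℝ} (h : g t ≠ g b) : levelInd 𝕜 g b t = 0 := if_neg h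

variable {a b c : ℝ}

/-- The level of `b` is an interval ending at `b`, with interior in `C_g`. A left endpoint `t < b`
belonging to it would be `0`, and then in `N_g⁻`, or would contradict left continuity of the
indicator. -/
lemma RegularOn.eq_of_level (hg : RegularOn g T) (hbD : b ∈ jumpSet g)
    (hi : GContinuousOn g 0 T (levelInd 𝕜 g b)) {t : ℝ} (ht : t ∈ Icc 0 T) (hC : t ∉ constSet g)
    (h : g t = g b) : t = b := by
  have hd := hg.toIsDerivator
  rcases lt_trichotomy t b with hlt | heq | hgt
  · exfalso
    have htD : t ∉ jumpSet g := fun hD => (hd.lt_of_mem_jumpSet hD hlt).ne h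
    rcases ht.1.eq_or_lt with h0 | h0
    · refine hg.notMem_leftEnds ⟨⟨h0 ▸ hC, b - t, by linarith, fun s hs => ?_⟩, h0 ▸ htD⟩
      rw [h0] at hs
      exact mem_constSet_of_lt hg.monotone hs.1 (show s < b by linarith [hs.2]) h
    · have hle : 𝓝[<] t ≤ 𝓝[Icc 0 T ∩ Iic t] t := by
        refine le_inf nhdsWithin_le_nhds (le_principal_iff.2 ?_)
        filter_upwards [Ioo_mem_nhdsLT h0] with s hs
          using ⟨⟨hs.1.le, hs.2.le.trans ht.2⟩, hs.2.le⟩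
      have h1 := (hi.continuousWithinAt_left hd ht).tendsto.mono_left hle
      rw [levelInd_of_eq h] at h1
      have h2 : Tendsto (levelInd 𝕜 g b) (𝓝[<] t) (𝓝 0) := by
        refine tendsto_const_nhds.congr' ?_
        filter_upwards [self_mem_nhdsWithin] with s hs
        refine (levelInd_of_ne fun hsb => hC ?_).symm
        exact mem_constSet_of_lt hg.monotone hs hlt hsb
      exact one_ne_zero (tendsto_nhds_unique h1 h2)
  · exact heq
  · exact absurd h (hd.lt_of_mem_jumpSet hbD hgt).ne'

/-- A level set that a `g`-continuous function separates from the left is an initial segment or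
begins with a jump. -/
lemma IsDerivator.level_structure (hg : IsDerivator g) (hb : b ∈ Icc 0 T) (hbD : b ∈ jumpSet g)
    {γ : ℝ → 𝕜} (hγ : GContinuousOn g 0 T γ) (h0 : ∀ s ∈ Icc 0 b, g s < g b → γ s = 0)
    (hne : γ b ≠ 0) :
    GContinuousOn g 0 T (levelInd 𝕜 g b) ∧ ((∀ s ∈ Icc 0 b, g s = g b) ∨
      ∃ a ∈ Ico 0 b, a ∈ jumpSet g ∧ ∀ s ∈ Ioc a b, g s = g b) := by
  -- Since `γ` vanishes on the lower levels, `‖γ b‖` as tolerance forces a gap of size `δ` in the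
  -- values of `g` below `g b`.
  obtain ⟨δ, hδ, hδγ⟩ := hγ b hb ‖γ b‖ (norm_pos_iff.2 hne)
  have hgap : ∀ s ∈ Icc 0 b, g s < g b → g s ≤ g b - δ := by
    intro s hs hlt
    by_contra hcon
    have := hδγ s ⟨hs.1, hs.2.trans hb.2⟩ (by rw [abs_of_pos] <;> linarith)
    rw [h0 s hs hlt, sub_zero] at this
    exact lt_irrefl _ this
  have hjump : 0 < jump g b := hbD
  refine ⟨fun t ht ε hε => ?_, ?_⟩
  · by_cases htb : g t = g b
    · refine ⟨min δ (jump g b), lt_min hδ hjump, fun s hs hst => ?_⟩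
      have h1 := hst.trans_le (min_le_left _ _)
      have h2 := hst.trans_le (min_le_right _ _)
      have hsb : g s = g b := by
        rcases le_or_gt s b with hle | hgt
        · refine (hg.monotone hle).eq_of_not_lt fun hlt => ?_
          have := hgap s ⟨hs.1, hle⟩ hlt
          rw [htb, abs_of_pos (by linarith)] at h1
          linarith
        · have := hg.add_jump_le hgt
          rw [htb, abs_sub_comm, abs_of_pos (by linarith)] at h2
          linarith
      rw [levelInd_of_eq htb, levelInd_of_eq hsb, sub_self, norm_zero]
      exact hε
    · refine ⟨|g t - g b|, abs_pos.2 (sub_ne_zero.2 htb), fun s hs hst => ?_⟩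
      have hsb : g s ≠ g b := fun hsb => lt_irrefl _ (hsb ▸ hst)
      rw [levelInd_of_ne htb, levelInd_of_ne hsb, sub_self, norm_zero]
      exact hε
  · by_cases hall : ∀ s ∈ Icc 0 b, g s = g b
    · exact Or.inl hall
    right
    set S := {s | s ∈ Icc 0 b ∧ g s < g b} with hS
    have hSne : S.Nonempty := by
      push Not at hall
      obtain ⟨s, hs, hsb⟩ := hall
      exact ⟨s, hs, lt_of_le_of_ne (hg.monotone hs.2) hsb⟩
    have hSbd : BddAbove S := ⟨b, fun s hs => hs.1.2⟩
    -- The gap persists at `A` by left continuity, so `A` is the last point below the level and `g`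
    -- jumps from there directly to `g b`.
    set A := sSup S
    obtain ⟨s₀, hs₀⟩ := hSne
    have hA0 : 0 ≤ A := hs₀.1.1.trans (le_csSup hSbd hs₀)
    have hAb : A ≤ b := csSup_le ⟨s₀, hs₀⟩ fun s hs => hs.1.2
    have hgA : g A ≤ g b - δ := by
      by_contra hcon
      have hcl : A ∈ closure S := csSup_mem_closure ⟨s₀, hs₀⟩ hSbd
      have hf : ∃ᶠ s in 𝓝[≤] A, g s ≤ g b - δ := by
        rw [mem_closure_iff_frequently] at hcl
        rw [nhdsWithin, frequently_inf_principal]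
        exact hcl.mono fun s hs => ⟨le_csSup hSbd hs, hgap s hs.1 hs.2⟩
      refine hf ?_
      filter_upwards [(hg.leftCts A).eventually (lt_mem_nhds (not_le.1 hcon))] with s hs
        using not_le.2 hs
    have hAlt : A < b := lt_of_le_of_ne hAb fun h => by rw [h] at hgA; linarith
    have hconst : ∀ s ∈ Ioc A b, g s = g b := by
      intro s hs
      refine (hg.monotone hs.2).eq_of_not_lt fun hlt => ?_
      exact absurd (le_csSup hSbd ⟨⟨hA0.trans hs.1.le, hs.2⟩, hlt⟩) (not_le.2 hs.1)
    refine ⟨A, ⟨hA0, hAlt⟩, ?_, hconst⟩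
    have h1 : Tendsto g (𝓝[>] A) (𝓝 (g b)) := by
      refine tendsto_const_nhds.congr' ?_
      filter_upwards [Ioc_mem_nhdsGT hAlt] with s hs using (hconst s hs).symm
    have h2 := tendsto_nhds_unique h1 (hg.tendsto_Ioi A)
    change 0 < jump g A
    linarith

lemma IsDerivator.add_jump_eq (hg : IsDerivator g) (hab : a < b)
    (hconst : ∀ s ∈ Ioc a b, g s = g b) : g a + jump g a = g b := by
  refine tendsto_nhds_unique (hg.tendsto_Ioi a) (tendsto_const_nhds.congr' ?_)
  filter_upwards [Ioc_mem_nhdsGT hab] with s hs using (hconst s hs).symm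

lemma IsDerivator.tendsto_quot_levelInd_self (hg : IsDerivator g) (hbD : b ∈ jumpSet g) :
    Tendsto (quot g (levelInd 𝕜 g b) b) (gFilter g T b) (𝓝 (-(jump g b : 𝕜)⁻¹)) := by
  have hpos : 0 < jump g b := hbD
  have hden : Tendsto (fun s => ((g s - g b : ℝ) : 𝕜)) (gFilter g T b) (𝓝 (jump g b : 𝕜)) := by
    have : Tendsto (fun s => g s - g b) (gFilter g T b) (𝓝 (jump g b)) := by
      simpa using (hg.tendsto_gFilter (T := T) b).sub_const (g b)
    exact (RCLike.continuous_ofReal.tendsto _).comp this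
  refine (hden.inv₀ (by exact_mod_cast hpos.ne')).neg.congr' ?_
  filter_upwards [hg.eventually_ne b] with s hs
  rw [quot, levelInd_of_ne hs, levelInd_of_eq rfl, zero_sub, neg_div, one_div]

lemma IsDerivator.tendsto_quot_levelInd_zero (hg : IsDerivator g) {t : ℝ}
    (h : g b < g t ∨ g t + jump g t < g b) :
    Tendsto (quot g (levelInd 𝕜 g b) t) (gFilter g T t) (𝓝 0) := by
  have h0 := hg.jump_nonneg t
  have htb : g t ≠ g b := by rcases h with h | h <;> intro h' <;> linarith
  have hlim : g t + jump g t ≠ g b := by rcases h with h | h <;> intro h' <;> linarith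
  refine tendsto_const_nhds.congr' ?_
  filter_upwards [(hg.tendsto_gFilter t).eventually_ne hlim] with s hs
  rw [quot, levelInd_of_ne hs, levelInd_of_ne htb, sub_self, zero_div]

lemma IsDerivator.tendsto_quot_levelInd_left (hg : IsDerivator g) (hab : a < b)
    (haD : a ∈ jumpSet g) (hconst : ∀ s ∈ Ioc a b, g s = g b) :
    Tendsto (quot g (levelInd 𝕜 g b) a) (gFilter g T a) (𝓝 (jump g a : 𝕜)⁻¹) := by
  have h1 := hg.add_jump_eq hab hconst
  have hpos : 0 < jump g a := haD
  refine tendsto_const_nhds.congr' ?_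
  rw [gFilter_of_mem haD]
  have : ∀ᶠ s in 𝓝[Ioi a ∩ Icc 0 T] a, s ∈ Ioc a b :=
    nhdsWithin_mono _ inter_subset_left (Ioc_mem_nhdsGT hab)
  filter_upwards [this] with s hs
  rw [quot, levelInd_of_eq (hconst s hs), levelInd_of_ne (by linarith), sub_zero, one_div,
    hconst s hs, ← h1, add_sub_cancel_left]

lemma RegularOn.hasGDerivAt_levelInd_initial (hg : RegularOn g T) (hb : b ∈ Icc 0 T)
    (hbD : b ∈ jumpSet g) (hi : MemBC g 0 T 0 (levelInd 𝕜 g b)) (hall : ∀ s ∈ Icc 0 b, g s = g b) :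
    ∀ t ∈ Icc 0 T, HasGDerivAt g 0 T (levelInd 𝕜 g b)
      (-(jump g b : 𝕜)⁻¹ * levelInd 𝕜 g b t) t := by
  have hd := hg.toIsDerivator
  refine hg.hasGDerivAt_of_notMem_constSet ((memBC_zero_const _).mul_zero hi).1 fun t ht hC => ?_
  by_cases htb : g t = g b
  · obtain rfl := hg.eq_of_level hbD hi.1 ht hC htb
    rw [levelInd_of_eq rfl, mul_one]
    exact hd.tendsto_quot_levelInd_self hbD
  · rw [levelInd_of_ne htb, mul_zero]
    refine hd.tendsto_quot_levelInd_zero (Or.inl ?_)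
    rcases le_or_gt t b with h | h
    · exact absurd (hall t ⟨ht.1, h⟩) htb
    · exact hd.lt_of_mem_jumpSet hbD h

/-- Off `C_g` only two points have a nonzero derivative: `a`, where the indicator rises across the
jump, and `b`, where it falls. Hence the reciprocals of the two jumps. -/
lemma RegularOn.hasGDerivAt_levelInd (hg : RegularOn g T) (hb : b ∈ Icc 0 T)
    (hbD : b ∈ jumpSet g) (hi : MemBC g 0 T 0 (levelInd 𝕜 g b)) (ha : a ∈ Ico 0 b)
    (haD : a ∈ jumpSet g) (hia : MemBC g 0 T 0 (levelInd 𝕜 g a))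
    (hconst : ∀ s ∈ Ioc a b, g s = g b) :
    ∀ t ∈ Icc 0 T, HasGDerivAt g 0 T (levelInd 𝕜 g b)
      (-(jump g b : 𝕜)⁻¹ * levelInd 𝕜 g b t + (jump g a : 𝕜)⁻¹ * levelInd 𝕜 g a t) t := by
  have hd := hg.toIsDerivator
  have haT : a ∈ Icc 0 T := ⟨ha.1, ha.2.le.trans hb.2⟩
  have hgab : g a < g b := hd.lt_of_mem_jumpSet haD ha.2
  refine hg.hasGDerivAt_of_notMem_constSet (((memBC_zero_const _).mul_zero hi).add_zero
    ((memBC_zero_const _).mul_zero hia)).1 fun t ht hC => ?_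
  by_cases htb : g t = g b
  · obtain rfl := hg.eq_of_level hbD hi.1 ht hC htb
    rw [levelInd_of_eq rfl, levelInd_of_ne hgab.ne', mul_one, mul_zero, add_zero]
    exact hd.tendsto_quot_levelInd_self hbD
  rw [levelInd_of_ne htb, mul_zero, zero_add]
  by_cases hta : g t = g a
  · obtain rfl := hg.eq_of_level haD hia.1 ht hC hta
    rw [levelInd_of_eq rfl, mul_one]
    exact hd.tendsto_quot_levelInd_left ha.2 haD hconst
  · rw [levelInd_of_ne hta, mul_zero]
    refine hd.tendsto_quot_levelInd_zero ?_
    rcases lt_trichotomy t a with h | h | h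
    · exact Or.inr ((hd.add_jump_le h).trans_lt hgab)
    · exact absurd (h ▸ rfl) hta
    · rcases le_or_gt t b with h' | h'
      · exact absurd (hconst t ⟨h, h'⟩) htb
      · exact Or.inl (hd.lt_of_mem_jumpSet hbD h')

lemma memBC_zero_levelInd (hi : GContinuousOn g 0 T (levelInd 𝕜 g b)) :
    MemBC g 0 T 0 (levelInd 𝕜 g b) := by
  refine ⟨hi, 1, fun t _ => ?_⟩
  unfold levelInd
  split_ifs <;> simp

/-- Combinations of indicators in `BC_g^m` of levels that end with a jump at or before `c`. -/
def levelSpan (𝕜 : Type*) [RCLike 𝕜] (g : ℝ → ℝ) (T : ℝ) (m : ℕ) (c : ℝ) :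
    Submodule 𝕜 (ℝ → 𝕜) :=
  Submodule.span 𝕜 {w | ∃ b ∈ Icc 0 c, b ∈ jumpSet g ∧ MemBC g 0 T m (levelInd 𝕜 g b) ∧
    w = levelInd 𝕜 g b}

lemma levelInd_mem_levelSpan {m : ℕ} (hb : b ∈ Icc 0 c) (hbD : b ∈ jumpSet g)
    (hi : MemBC g 0 T m (levelInd 𝕜 g b)) : levelInd 𝕜 g b ∈ levelSpan 𝕜 g T m c :=
  Submodule.subset_span ⟨b, hb, hbD, hi, rfl⟩

lemma levelSpan_mono {m : ℕ} (hbc : b ≤ c) : levelSpan 𝕜 g T m b ≤ levelSpan 𝕜 g T m c := by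
  refine Submodule.span_mono ?_
  rintro w ⟨x, hx, h⟩
  exact ⟨x, ⟨hx.1, hx.2.trans hbc⟩, h⟩

lemma RegularOn.memBC_of_mem_levelSpan (hg : RegularOn g T) {m : ℕ} {w : ℝ → 𝕜}
    (hw : w ∈ levelSpan 𝕜 g T m c) : MemBC g 0 T m w := by
  induction hw using Submodule.span_induction with
  | mem w h =>
    obtain ⟨b, -, -, hb, rfl⟩ := h
    exact hb
  | zero => exact (hg.goodMul_zero m).memBC
  | add x y _ _ hx hy => exact hg.memBC_add hx hy
  | smul a x _ hx => exact hg.memBC_const_mul a hx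

/-- If a function in `BC_g^{m+1}` separates the level of the jump point `b` from the left, then the
indicator of this level is `g`-differentiable within the span of such indicators. -/
lemma RegularOn.exists_deriv_levelInd_aux (hg : RegularOn g T) {m : ℕ}
    (ih : ∀ (γ : ℝ → 𝕜) (b : ℝ), b ∈ Icc 0 T → b ∈ jumpSet g → MemBC g 0 T m γ →
      (∀ s ∈ Icc 0 b, g s < g b → γ s = 0) → γ b ≠ 0 → MemBC g 0 T m (levelInd 𝕜 g b))
    {γ : ℝ → 𝕜} (hb : b ∈ Icc 0 T) (hbD : b ∈ jumpSet g) (hγ : MemBC g 0 T (m + 1) γ)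
    (h0 : ∀ s ∈ Icc 0 b, g s < g b → γ s = 0) (hne : γ b ≠ 0) :
    ∃ w ∈ levelSpan 𝕜 g T m b, ∀ t ∈ Icc 0 T, HasGDerivAt g 0 T (levelInd 𝕜 g b) (w t) t := by
  have hd := hg.toIsDerivator
  obtain ⟨hi, hstr⟩ := hd.level_structure hb hbD hγ.gContinuousOn h0 hne
  have hbm := ih γ b hb hbD hγ.of_succ h0 hne
  have hbs : levelInd 𝕜 g b ∈ levelSpan 𝕜 g T m b :=
    levelInd_mem_levelSpan ⟨hb.1, le_rfl⟩ hbD hbm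
  rcases hstr with hall | ⟨a, ha, haD, hconst⟩
  · exact ⟨_, Submodule.smul_mem _ (-(jump g b : 𝕜)⁻¹) hbs,
      hg.hasGDerivAt_levelInd_initial hb hbD (memBC_zero_levelInd hi) hall⟩
  · have haT : a ∈ Icc 0 T := ⟨ha.1, ha.2.le.trans hb.2⟩
    have hgab : g a < g b := hd.lt_of_mem_jumpSet haD ha.2
    have hzero : ∀ s ∈ Icc 0 a, γ s = 0 := fun s hs =>
      h0 s ⟨hs.1, hs.2.trans ha.2.le⟩ ((hg.monotone hs.2).trans_lt hgab)
    obtain ⟨-, h, hder, hh⟩ := id hγ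
    have haC : a ∉ constSet g := fun hC => hd.notMem_jumpSet hC haD
    -- Across the jump at `a`, `γ` passes from `0` to `γ b`. So `h`, the derivative of `γ`, is
    -- nonzero at `a` and vanishes on the lower levels, and `ih` applies to it at `a`.
    have hha : h a = γ b * (jump g a : 𝕜)⁻¹ := by
      have hle := nhdsWithin_Ioi_le_gFilter (g := g) ha.1 (ha.2.trans_le hb.2)
        fun s hs => hd.lt_of_mem_jumpSet haD hs
      have : (gFilter g T a).NeBot := NeBot.mono inferInstance hle
      refine tendsto_nhds_unique (hg.tendsto_quot hder haT haC)
        (((hd.tendsto_quot_levelInd_left ha.2 haD hconst).const_mul (γ b)).congr' ?_)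
      rw [gFilter_of_mem haD]
      have : ∀ᶠ s in 𝓝[Ioi a ∩ Icc 0 T] a, s ∈ Ioc a b :=
        nhdsWithin_mono _ inter_subset_left (Ioc_mem_nhdsGT ha.2)
      filter_upwards [this] with s hs
      rw [quot, quot, levelInd_of_eq (hconst s hs), levelInd_of_ne hgab.ne,
        hzero a ⟨ha.1, le_rfl⟩, hγ.gContinuousOn.eq_of_eq (s := s) (t := b)
          ⟨ha.1.trans hs.1.le, hs.2.trans hb.2⟩ hb (hconst s hs)]
      ring
    have ham := ih h a haT haD hh (fun s hs hlt => hg.deriv_eq_zero hh.gContinuousOn hder hs.1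
      haT.2 (fun r hr => by rw [hzero r ⟨hs.1.trans hr.1, hr.2⟩, hzero s hs]) hlt) (by
        rw [hha]
        have : 0 < jump g a := haD
        exact mul_ne_zero hne (inv_ne_zero (by exact_mod_cast this.ne')))
    have has : levelInd 𝕜 g a ∈ levelSpan 𝕜 g T m b :=
      levelInd_mem_levelSpan ⟨ha.1, ha.2.le⟩ haD ham
    exact ⟨_, Submodule.add_mem _ (Submodule.smul_mem _ (-(jump g b : 𝕜)⁻¹) hbs)
      (Submodule.smul_mem _ ((jump g a : 𝕜)⁻¹) has),
      hg.hasGDerivAt_levelInd hb hbD (memBC_zero_levelInd hi) ha haD ham.toZero hconst⟩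

/-- Differentiating the separating function costs one order and moves the separated level one jump
to the left, which is what the induction on `m` follows. -/
lemma RegularOn.memBC_levelInd (hg : RegularOn g T) (m : ℕ) (γ : ℝ → 𝕜) (b : ℝ)
    (hb : b ∈ Icc 0 T) (hbD : b ∈ jumpSet g) (hγ : MemBC g 0 T m γ)
    (h0 : ∀ s ∈ Icc 0 b, g s < g b → γ s = 0) (hne : γ b ≠ 0) :
    MemBC g 0 T m (levelInd 𝕜 g b) := by
  induction m generalizing γ b with
  | zero =>
    exact memBC_zero_levelInd
      (hg.toIsDerivator.level_structure hb hbD hγ.gContinuousOn h0 hne).1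
  | succ m ih =>
    obtain ⟨w, hw, hder⟩ := hg.exists_deriv_levelInd_aux ih hb hbD hγ h0 hne
    exact ⟨memBC_zero_levelInd
      (hg.toIsDerivator.level_structure hb hbD hγ.gContinuousOn h0 hne).1, w, hder,
      hg.memBC_of_mem_levelSpan hw⟩

/-- The indicator itself serves as the separating function. -/
lemma RegularOn.exists_deriv_levelInd (hg : RegularOn g T) {m : ℕ} (hb : b ∈ Icc 0 T)
    (hbD : b ∈ jumpSet g) (hi : MemBC g 0 T (m + 1) (levelInd 𝕜 g b)) :
    ∃ w ∈ levelSpan 𝕜 g T m b, ∀ t ∈ Icc 0 T, HasGDerivAt g 0 T (levelInd 𝕜 g b) (w t) t :=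
  hg.exists_deriv_levelInd_aux (hg.memBC_levelInd m) hb hbD hi
    (fun _ _ hlt => levelInd_of_ne hlt.ne) (by rw [levelInd_of_eq rfl]; exact one_ne_zero)

lemma RegularOn.exists_deriv_of_mem_levelSpan (hg : RegularOn g T) {m : ℕ} (hc : c ≤ T)
    {w : ℝ → 𝕜} (hw : w ∈ levelSpan 𝕜 g T (m + 1) c) :
    ∃ w' ∈ levelSpan 𝕜 g T m c, ∀ t ∈ Icc 0 T, HasGDerivAt g 0 T w (w' t) t := by
  induction hw using Submodule.span_induction with
  | mem w h =>
    obtain ⟨b, hb, hbD, hi, rfl⟩ := h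
    obtain ⟨w', hw', hder⟩ := hg.exists_deriv_levelInd ⟨hb.1, hb.2.trans hc⟩ hbD hi
    exact ⟨w', levelSpan_mono hb.2 hw', hder⟩
  | zero =>
    refine ⟨0, Submodule.zero_mem _, hg.hasGDerivAt_of_notMem_constSet (memBC_zero_const 0).1
      fun t _ _ => tendsto_const_nhds.congr fun s => by simp [quot]⟩
  | add x y _ _ hx hy =>
    obtain ⟨x', hx', hxd⟩ := hx
    obtain ⟨y', hy', hyd⟩ := hy
    exact ⟨_, Submodule.add_mem _ hx' hy', hg.hasGDerivAt_add hxd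
      (hg.memBC_of_mem_levelSpan hx').toZero hyd (hg.memBC_of_mem_levelSpan hy').toZero⟩
  | smul a x _ hx =>
    obtain ⟨x', hx', hxd⟩ := hx
    exact ⟨_, Submodule.smul_mem _ a hx', hg.hasGDerivAt_const_mul a hxd
      (hg.memBC_of_mem_levelSpan hx').toZero⟩

/-- Off `C_g` the indicator of the level of `b` is supported at `b` alone, so multiplying it by
`Δ⁺g` amounts to multiplying by the constant `jump g b`. -/
lemma RegularOn.exists_mul_jump (hg : RegularOn g T) {m : ℕ}
    {w : ℝ → 𝕜} (hw : w ∈ levelSpan 𝕜 g T m c) :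
    ∃ u ∈ levelSpan 𝕜 g T m c, ∀ t ∈ Icc 0 T, t ∉ constSet g → u t = w t * (jump g t : 𝕜) := by
  induction hw using Submodule.span_induction with
  | mem w h =>
    obtain ⟨b, hb, hbD, hi, rfl⟩ := h
    refine ⟨_, Submodule.smul_mem _ (jump g b : 𝕜) (levelInd_mem_levelSpan hb hbD hi),
      fun t ht hC => ?_⟩
    by_cases htb : g t = g b
    · obtain rfl := hg.eq_of_level hbD hi.gContinuousOn ht hC htb
      simp [mul_comm]
    · simp [levelInd_of_ne htb]
  | zero => exact ⟨0, Submodule.zero_mem _, fun t _ _ => by simp⟩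
  | add x y _ _ hx hy =>
    obtain ⟨x', hx', hxd⟩ := hx
    obtain ⟨y', hy', hyd⟩ := hy
    refine ⟨_, Submodule.add_mem _ hx' hy', fun t ht hC => ?_⟩
    rw [Pi.add_apply, Pi.add_apply, hxd t ht hC, hyd t ht hC, add_mul]
  | smul a x _ hx =>
    obtain ⟨x', hx', hxd⟩ := hx
    refine ⟨_, Submodule.smul_mem _ a hx', fun t ht hC => ?_⟩
    rw [Pi.smul_apply, Pi.smul_apply, hxd t ht hC, smul_mul_assoc]

lemma IsDerivator.levelSpan_apply_eq_zero (hg : IsDerivator g) {m : ℕ} {w : ℝ → 𝕜}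
    (hw : w ∈ levelSpan 𝕜 g T m c) {t : ℝ} (ht : c < t) : w t = 0 := by
  induction hw using Submodule.span_induction with
  | mem w h =>
    obtain ⟨b, hb, hbD, hi, rfl⟩ := h
    exact levelInd_of_ne (hg.lt_of_mem_jumpSet hbD (hb.2.trans_lt ht)).ne'
  | zero => rfl
  | add x y _ _ hx hy => rw [Pi.add_apply, hx, hy, add_zero]
  | smul a x _ hx => rw [Pi.smul_apply, hx, smul_zero]

lemma RegularOn.goodMul_of_mem_levelSpan (hg : RegularOn g T) {m : ℕ} (hc : c ≤ T)
    {w : ℝ → 𝕜} (hw : w ∈ levelSpan 𝕜 g T m c) : GoodMul g T m w := by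
  induction m generalizing w with
  | zero => exact hg.memBC_of_mem_levelSpan hw
  | succ m ih =>
    obtain ⟨w', hw', hder⟩ := hg.exists_deriv_of_mem_levelSpan hc hw
    obtain ⟨u, hu, huj⟩ := hg.exists_mul_jump hw'
    exact ⟨(hg.memBC_of_mem_levelSpan hw).toZero, w', hder, ih hw', u, ih hu, huj⟩

/-- A function whose higher derivatives vanish at the jumps beyond `c`, and which is a combination
of level indicators up to `c`, is a good multiplier. -/
lemma RegularOn.goodMul_of_vanish (hg : RegularOn g T) {n : ℕ} {γ : ℕ → ℝ → 𝕜}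
    (hγ : ∀ k ≤ n, MemBC g 0 T (n - k) (γ k))
    (hder : ∀ k < n, ∀ t ∈ Icc 0 T, HasGDerivAt g 0 T (γ k) (γ (k + 1) t) t)
    (hc : c ∈ Icc 0 T) (hcD : c ∈ jumpSet g)
    (hvan : ∀ k, 1 ≤ k → k ≤ n → ∀ t ∈ Icc 0 T, t ∈ jumpSet g → c < t → γ k t = 0)
    {m k : ℕ} (hkm : k + m = n) {w : ℝ → 𝕜} (hw : w ∈ levelSpan 𝕜 g T m c)
    (hwγ : EqOn (γ k) w (Icc 0 c)) : GoodMul g T m (γ k) := by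
  have hd := hg.toIsDerivator
  induction m generalizing k w with
  | zero => exact (hγ k (by omega)).toZero
  | succ m ih =>
    obtain ⟨w', hw', hwd⟩ := hg.exists_deriv_of_mem_levelSpan hc.2 hw
    have hw'BC := hg.memBC_of_mem_levelSpan hw'
    have hk1 : MemBC g 0 T m (γ (k + 1)) := by
      have := hγ (k + 1) (by omega)
      rwa [show n - (k + 1) = m by omega] at this
    -- `γ k - w` vanishes on `[0, c]`, so its derivative `G` vanishes there below the level of `c`
    -- and is `G c` times the indicator of that level. If `G c ≠ 0`, `G` itself shows that this
    -- indicator is in `BC_g^m`.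
    set G : ℝ → 𝕜 := fun t => γ (k + 1) t + (-1) * w' t with hG
    have hGBC : MemBC g 0 T m G := hg.memBC_add hk1 (hg.memBC_const_mul _ hw'BC)
    have hGd := hg.hasGDerivAt_add (hder k (by omega)) hk1.toZero
      (hg.hasGDerivAt_const_mul (-1) hwd hw'BC.toZero) ((memBC_zero_const _).mul_zero hw'BC.toZero)
    have hG0 : ∀ s ∈ Icc 0 c, g s < g c → G s = 0 := by
      intro s hs hlt
      refine hg.deriv_eq_zero hGBC.gContinuousOn hGd hs.1 hc.2 (fun r hr => ?_) hlt
      rw [hwγ ⟨hs.1.trans hr.1, hr.2⟩, hwγ hs]; ring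
    have hGs : (G c) • levelInd 𝕜 g c ∈ levelSpan 𝕜 g T m c := by
      by_cases hGc : G c = 0
      · rw [hGc, zero_smul]; exact Submodule.zero_mem _
      · exact Submodule.smul_mem _ _ (levelInd_mem_levelSpan ⟨hc.1, le_rfl⟩ hcD
          (hg.memBC_levelInd m G c hc hcD hGBC hG0 hGc))
    have hsum := Submodule.add_mem _ hw' hGs
    have hEq : EqOn (γ (k + 1)) (w' + G c • levelInd 𝕜 g c) (Icc 0 c) := by
      intro s hs
      have hval : G s = G c * levelInd 𝕜 g c s := by
        by_cases hsc : g s = g c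
        · rw [levelInd_of_eq hsc, mul_one]
          exact hGBC.gContinuousOn.eq_of_eq ⟨hs.1, hs.2.trans hc.2⟩ hc hsc
        · rw [levelInd_of_ne hsc, mul_zero]
          exact hG0 s hs (lt_of_le_of_ne (hg.monotone hs.2) hsc)
      rw [Pi.add_apply, Pi.smul_apply, smul_eq_mul, ← hval, hG]
      ring
    obtain ⟨u, hu, huj⟩ := hg.exists_mul_jump hsum
    refine ⟨(hγ k (by omega)).toZero, γ (k + 1), hder k (by omega),
      ih (by omega) hsum hEq, u, hg.goodMul_of_mem_levelSpan hc.2 hu, fun t ht hC => ?_⟩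
    -- Up to `c` this is the choice of `u`; beyond `c` both sides are `0`.
    rcases le_or_gt t c with htc | htc
    · rw [huj t ht hC, hEq ⟨ht.1, htc⟩]
    · rw [hd.levelSpan_apply_eq_zero hu htc]
      by_cases htD : t ∈ jumpSet g
      · rw [hvan (k + 1) (by omega) (by omega) t ht htD htc, zero_mul]
      · rw [hd.jump_eq_zero htD]; simp

end Level

/-! ### Comparison of `g`- and `g^C`-derivatives; smooth coefficients are multipliers -/

section Compare

lemma MemBC.exists_seq {a b : ℝ} {n : ℕ} {f : ℝ → 𝕜} (hf : MemBC g a b n f) :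
    ∃ γ : ℕ → ℝ → 𝕜, γ 0 = f ∧ (∀ k ≤ n, MemBC g a b (n - k) (γ k)) ∧
      ∀ k < n, ∀ t ∈ Icc a b, HasGDerivAt g a b (γ k) (γ (k + 1) t) t := by
  induction n generalizing f with
  | zero =>
    refine ⟨fun _ => f, rfl, fun k hk => ?_, fun k hk => absurd hk (Nat.not_lt_zero k)⟩
    simpa using hf
  | succ n ih =>
    obtain ⟨f0, h, hder, hh⟩ := id hf
    obtain ⟨γ, h0, h1, h2⟩ := ih hh
    refine ⟨fun k => Nat.casesOn k f γ, rfl, fun k hk => ?_, fun k hk t ht => ?_⟩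
    · cases k with
      | zero => exact hf
      | succ k =>
        rw [Nat.succ_sub_succ]
        exact h1 k (by omega)
    · cases k with
      | zero =>
        change HasGDerivAt g a b f (γ 0 t) t
        rw [h0]; exact hder t ht
      | succ k => exact h2 k (by omega) t ht

/-- The points of `[0, T]` to the left of which `g^C` is strictly smaller, beyond the initial
level of `g^C`. -/
def leftStrict (g : ℝ → ℝ) (T : ℝ) : Set ℝ :=
  {a | a ∈ Icc 0 T ∧ contPart g 0 0 < contPart g 0 a ∧
    ∀ s ∈ Ico 0 a, contPart g 0 s < contPart g 0 a}

/-- The leftmost point of the `g^C`-level of `t` in `[0, t]`, which lies on the level because `g^C`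
is continuous. -/
lemma IsDerivator.exists_leftStrict (hg : IsDerivator g) {t : ℝ} (ht : t ∈ Icc 0 T)
    (h0 : contPart g 0 0 < contPart g 0 t) :
    ∃ a ∈ leftStrict g T, a ≤ t ∧ contPart g 0 a = contPart g 0 t := by
  set S := {s | s ∈ Icc 0 t ∧ contPart g 0 s = contPart g 0 t} with hS
  have htS : t ∈ S := ⟨⟨ht.1, le_rfl⟩, rfl⟩
  have hbd : BddBelow S := ⟨0, fun s hs => hs.1.1⟩
  set a := sInf S
  have ha0 : 0 ≤ a := le_csInf ⟨t, htS⟩ fun s hs => hs.1.1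
  have hat : a ≤ t := csInf_le hbd htS
  have hval : contPart g 0 a = contPart g 0 t := by
    by_contra hne
    have hcl : a ∈ closure S := csInf_mem_closure ⟨t, htS⟩ hbd
    have hf : ∃ᶠ s in 𝓝[Icc 0 T] a, contPart g 0 s = contPart g 0 t := by
      rw [mem_closure_iff_frequently] at hcl
      rw [nhdsWithin, frequently_inf_principal]
      exact hcl.mono fun s hs => ⟨⟨hs.1.1, hs.1.2.trans ht.2⟩, hs.2⟩
    exact hf ((hg.contPart_tendsto ha0).eventually_ne hne)
  refine ⟨a, ⟨⟨ha0, hat.trans ht.2⟩, hval ▸ h0, fun s hs => ?_⟩, hat, hval⟩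
  refine lt_of_le_of_ne (hg.contPart_mono hs.1 hs.2.le) fun h => ?_
  exact absurd (csInf_le hbd ⟨⟨hs.1, hs.2.le.trans hat⟩, h.trans hval⟩) (not_le.2 hs.2)

variable {F H K e e' : ℝ → 𝕜}

/-- If the derivative vanishes at the jumps, the function is constant where `g^C` is. -/
lemma RegularOn.eq_of_contPart_eq (hg : RegularOn g T) (hF : MemBC g 0 T 0 F)
    (hH : MemBC g 0 T 0 H) (hFH : ∀ t ∈ Icc 0 T, HasGDerivAt g 0 T F (H t) t) {x y : ℝ}
    (hx : 0 ≤ x) (hxy : x ≤ y) (hy : y ≤ T) (h0 : ∀ r ∈ Ico x y, r ∈ jumpSet g → H r = 0)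
    (hC : contPart g 0 x = contPart g 0 y) : F y = F x := by
  obtain ⟨M, -, hM⟩ := hH.exists_bound
  have h1 := hg.toIsDerivator.norm_int_sub_contPart_le hH hx hxy hy h0 (x := 0) (C := M)
    fun r hr _ => by rw [sub_zero]; exact hM r ⟨hx.trans hr.1, hr.2.le.trans hy⟩
  rw [hC, sub_self, mul_zero, zero_mul, sub_zero] at h1
  have h2 := sub_eq_zero.1 (norm_le_zero_iff.1 h1)
  rw [hg.eq_add_int hF hH hFH ⟨hx.trans hxy, hy⟩, hg.eq_add_int hF hH hFH ⟨hx, hxy.trans hy⟩, h2]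

lemma RegularOn.tendsto_right (hg : RegularOn g T)
    (hHK : ∀ t ∈ Icc 0 T, HasGDerivAt g 0 T H (K t) t) {t : ℝ} (ht : t ∈ Icc 0 T)
    (htD : t ∈ jumpSet g) :
    t < T ∧ Tendsto H (𝓝[>] t) (𝓝 (H t + K t * (jump g t : 𝕜))) := by
  have hd := hg.toIsDerivator
  have htT : t < T := lt_of_le_of_ne ht.2 fun h => hg.notMem_jumpSet_right (h ▸ htD)
  refine ⟨htT, (hd.tendsto_of_quot (hg.tendsto_quot hHK ht
    fun hC => hd.notMem_jumpSet hC htD)).mono_left ?_⟩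
  exact nhdsWithin_Ioi_le_gFilter ht.1 htT fun s hs => hd.lt_of_mem_jumpSet htD hs

lemma IsDerivator.tendsto_right_of_contPart (hg : IsDerivator g)
    (he : GContinuousOn (contPart g 0) 0 T e) {t : ℝ} (h0 : 0 ≤ t) (htT : t < T) :
    Tendsto e (𝓝[>] t) (𝓝 (e t)) := by
  refine he.tendsto ⟨h0, htT.le⟩ ?_ (hg.contPart_tendsto_right h0)
  filter_upwards [Ioo_mem_nhdsGT htT] with s hs using ⟨h0.trans hs.1.le, hs.2.le⟩

/-- A `g^C`-continuous function has vanishing `g`-derivative at the jumps. -/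
lemma RegularOn.deriv_eq_zero_of_contPart (hg : RegularOn g T)
    (he : GContinuousOn (contPart g 0) 0 T H)
    (hHK : ∀ t ∈ Icc 0 T, HasGDerivAt g 0 T H (K t) t) {t : ℝ} (ht : t ∈ Icc 0 T)
    (htD : t ∈ jumpSet g) : K t = 0 := by
  obtain ⟨htT, h1⟩ := hg.tendsto_right hHK ht htD
  -- The limit of `H` from the right is `H t + K t * jump g t` by differentiability and `H t` by
  -- `g^C`-continuity.
  have h2 := tendsto_nhds_unique h1 (hg.toIsDerivator.tendsto_right_of_contPart he ht.1 htT)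
  have h3 : 0 < jump g t := htD
  have h4 : (jump g t : 𝕜) ≠ 0 := by exact_mod_cast h3.ne'
  simpa [h4] using h2

/-- If `g^C` is constant just after `d`, so is `F`, and its derivative vanishes at `d`. Otherwise
points of `leftStrict` accumulate at `d` from the right; there `H = e`, while `H` tends to `H d` and
`e` to `0`. -/
lemma RegularOn.eq_zero_of_not_jump (hg : RegularOn g T) (hF : MemBC g 0 T 0 F)
    (hH : MemBC g 0 T 0 H) (hFH : ∀ t ∈ Icc 0 T, HasGDerivAt g 0 T F (H t) t)
    (he : GContinuousOn (contPart g 0) 0 T e) (hA : ∀ a ∈ leftStrict g T, H a = e a)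
    (hB : ∀ t ∈ Icc 0 T, t ∈ jumpSet g → contPart g 0 0 < contPart g 0 t → H t = 0)
    {d : ℝ} (hd0 : 0 ≤ d) (hdT : d < T) (hdD : d ∉ jumpSet g) (hgt : ∀ y, d < y → g d < g y)
    (hdG : contPart g 0 0 < contPart g 0 d) (hed : e d = 0) : H d = 0 := by
  have hd := hg.toIsDerivator
  by_cases hex : ∃ y ∈ Ioc d T, contPart g 0 y = contPart g 0 d
  · obtain ⟨y, hy, hyd⟩ := hex
    refine hg.deriv_eq_zero hH.1 hFH hd0 hy.2 (fun s hs => ?_) (hgt y hy.1)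
    refine hg.eq_of_contPart_eq hF hH hFH hd0 hs.1 (hs.2.trans hy.2) (fun r hr hrD => ?_) ?_
    · exact hB r ⟨hd0.trans hr.1, hr.2.le.trans (hs.2.trans hy.2)⟩ hrD
        (hdG.trans_le (hd.contPart_mono hd0 hr.1))
    · exact le_antisymm (hd.contPart_mono hd0 hs.1)
        (hyd ▸ hd.contPart_mono (hd0.trans hs.1) hs.2)
  · push Not at hex
    by_contra hne
    have hpos : 0 < ‖H d‖ := norm_pos_iff.2 hne
    have hI : ∀ᶠ s in 𝓝[>] d, s ∈ Ioo d T := Ioo_mem_nhdsGT hdT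
    have h1 : Tendsto H (𝓝[>] d) (𝓝 (H d)) := by
      refine hH.1.tendsto ⟨hd0, hdT.le⟩ ?_ ((hd.continuousAt hdD).tendsto.mono_left
        nhdsWithin_le_nhds)
      filter_upwards [hI] with s hs using ⟨hd0.trans hs.1.le, hs.2.le⟩
    have h2 := (hd.tendsto_right_of_contPart he hd0 hdT).norm
    rw [hed, norm_zero] at h2
    obtain ⟨u, hu, hu'⟩ := mem_nhdsGT_iff_exists_Ioc_subset.1 (inter_mem hI
      (inter_mem (h1.norm.eventually (lt_mem_nhds (half_lt_self hpos)))
        (h2.eventually (gt_mem_nhds (half_pos hpos)))))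
    have huT := (hu' ⟨hu, le_rfl⟩).1
    have huI : u ∈ Icc 0 T := ⟨hd0.trans huT.1.le, huT.2.le⟩
    have hlt : contPart g 0 d < contPart g 0 u :=
      lt_of_le_of_ne (hd.contPart_mono hd0 huT.1.le) (hex u ⟨huT.1, huT.2.le⟩).symm
    obtain ⟨a, haR, hau, haG⟩ := hd.exists_leftStrict huI (hdG.trans hlt)
    have hda : d < a := by
      by_contra hcon
      have := hd.contPart_mono haR.1.1 (not_lt.1 hcon)
      linarith
    have h3 := hu' ⟨hda, hau⟩
    have h4 : ‖H d‖ / 2 < ‖H a‖ := h3.2.1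
    have h5 : ‖e a‖ < ‖H d‖ / 2 := h3.2.2
    rw [hA a haR] at h4
    exact lt_asymm h4 h5

/-- The vanishing of the derivatives at the jumps passes to the next order. -/
lemma RegularOn.vanish_succ (hg : RegularOn g T) (hF : MemBC g 0 T 0 F)
    (hH : MemBC g 0 T 0 H) (hFH : ∀ t ∈ Icc 0 T, HasGDerivAt g 0 T F (H t) t)
    (hHK : ∀ t ∈ Icc 0 T, HasGDerivAt g 0 T H (K t) t)
    (he : GContinuousOn (contPart g 0) 0 T e) (hA : ∀ a ∈ leftStrict g T, H a = e a)
    (hB : ∀ t ∈ Icc 0 T, t ∈ jumpSet g → contPart g 0 0 < contPart g 0 t → H t = 0)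
    {t : ℝ} (ht : t ∈ Icc 0 T) (htD : t ∈ jumpSet g) (htG : contPart g 0 0 < contPart g 0 t) :
    K t = 0 := by
  have hd := hg.toIsDerivator
  have hconst : ∀ x y, 0 ≤ x → y ≤ T → contPart g 0 0 < contPart g 0 x →
      contPart g 0 x = contPart g 0 y → ∀ s ∈ Icc x y, F s = F x := by
    intro x y hx hy hxG hxy s hs
    refine hg.eq_of_contPart_eq hF hH hFH hx hs.1 (hs.2.trans hy) (fun r hr hrD => ?_) ?_
    · exact hB r ⟨hx.trans hr.1, hr.2.le.trans (hs.2.trans hy)⟩ hrD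
        (hxG.trans_le (hd.contPart_mono hx hr.1))
    · exact le_antisymm (hd.contPart_mono hx hs.1) (hxy ▸ hd.contPart_mono (hx.trans hs.1) hs.2)
  obtain ⟨htT, hlim⟩ := hg.tendsto_right hHK ht htD
  have hHt := hB t ht htD htG
  -- `e` is constant on the `g^C`-level of `t`, and `e a = H a` at its leftmost point `a`. `H a`
  -- vanishes either because `g a = g t` or because `F` is constant on `[a, t]`.
  have het : e t = 0 := by
    obtain ⟨a, haR, hat, haG⟩ := hd.exists_leftStrict ht htG
    rw [← he.eq_of_eq haR.1 ht haG, ← hA a haR]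
    rcases (hg.monotone hat).eq_or_lt with h | h
    · rw [hH.1.eq_of_eq haR.1 ht h, hHt]
    · exact hg.deriv_eq_zero hH.1 hFH haR.1.1 ht.2 (hconst a t haR.1.1 ht.2 haR.2.1 haG) h
  -- This is the limit of `H` from the right. If it were nonzero, `‖H‖ > L / 2 > ‖e‖` on some `(t,
  -- u]`, which is incompatible with a zero of `H` or a point of `leftStrict` there.
  have hzero : H t + K t * (jump g t : 𝕜) = 0 := by
    by_contra hne
    have hpos : 0 < ‖H t + K t * (jump g t : 𝕜)‖ := norm_pos_iff.2 hne
    set L := ‖H t + K t * (jump g t : 𝕜)‖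
    have h2 := (hd.tendsto_right_of_contPart he ht.1 htT).norm
    rw [het, norm_zero] at h2
    obtain ⟨u, hu, hu'⟩ := mem_nhdsGT_iff_exists_Ioc_subset.1 (inter_mem (Ioo_mem_nhdsGT htT)
      (inter_mem (hlim.norm.eventually (lt_mem_nhds (half_lt_self hpos)))
        (h2.eventually (gt_mem_nhds (half_pos hpos)))))
    have huT := (hu' ⟨hu, le_rfl⟩).1
    have huI : u ∈ Icc 0 T := ⟨ht.1.trans huT.1.le, huT.2.le⟩
    have hbig : ∀ s ∈ Ioc t u, L / 2 < ‖H s‖ := fun s hs => (hu' hs).2.1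
    have hsmall : ∀ s ∈ Ioc t u, ‖e s‖ < L / 2 := fun s hs => (hu' hs).2.2
    rcases (hd.contPart_mono ht.1 huT.1.le).eq_or_lt with heq | hlt
    · obtain ⟨s, hts, hsu⟩ := exists_between huT.1
      have hs0 : 0 ≤ s := ht.1.trans hts.le
      have hsI : s ∈ Icc 0 T := ⟨hs0, hsu.le.trans huI.2⟩
      have hsG : contPart g 0 s = contPart g 0 t :=
        le_antisymm (heq ▸ hd.contPart_mono hs0 hsu.le) (hd.contPart_mono ht.1 hts.le)
      have hHs : H s = 0 := by
        rcases (hg.monotone hsu.le).eq_or_lt with h | h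
        -- With `g` constant on `[s, u]`, the value `H s` is read off at the top of the level.
        · obtain ⟨d, hds, hgd, hgt⟩ := hg.exists_top (hsu.trans huT.2)
          have hd0 : 0 ≤ d := hs0.trans hds.1
          have hdI : d ∈ Icc 0 T := ⟨hd0, hds.2.le⟩
          have hdG : contPart g 0 d = contPart g 0 t := by
            have h3 := hd.contPart_sub_le hs0 hds.1
            have h4 := hd.contPart_mono hs0 hds.1
            rw [hgd] at h3
            linarith
          rw [hH.1.eq_of_eq hsI hdI hgd.symm]
          by_cases hdD : d ∈ jumpSet g
          · exact hB d hdI hdD (hdG ▸ htG)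
          · exact hg.eq_zero_of_not_jump hF hH hFH he hA hB hd0 hds.2 hdD
              (fun y hy => hgd ▸ hgt y hy) (hdG ▸ htG) (by rw [he.eq_of_eq hdI ht hdG, het])
        · exact hg.deriv_eq_zero hH.1 hFH hs0 huI.2
            (hconst s u hs0 huI.2 (hsG ▸ htG) (hsG.trans heq)) h
      have := hbig s ⟨hts, hsu.le⟩
      rw [hHs, norm_zero] at this
      linarith
    · obtain ⟨a, haR, hau, haG⟩ := hd.exists_leftStrict huI (htG.trans hlt)
      have hta : t < a := by
        by_contra hcon
        have := hd.contPart_mono haR.1.1 (not_lt.1 hcon)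
        linarith
      have h4 := hbig a ⟨hta, hau⟩
      rw [hA a haR] at h4
      exact lt_asymm h4 (hsmall a ⟨hta, hau⟩)
  have h3 : 0 < jump g t := htD
  have h4 : (jump g t : 𝕜) ≠ 0 := by exact_mod_cast h3.ne'
  rw [hHt, zero_add] at hzero
  exact (mul_eq_zero.1 hzero).resolve_right h4

/-- Provides a proper filter for comparing derivatives from the left. By continuity `g^C` exceeds
`g^C(x)` at some `s` in `(x, a)`, and the leftmost point of the level of `s` lies in `(x, s]`. -/
lemma IsDerivator.mem_closure_leftStrict (hg : IsDerivator g) {a : ℝ} (ha : a ∈ leftStrict g T) :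
    a ∈ closure (leftStrict g T ∩ Iio a) := by
  have ha0 : 0 < a := lt_of_le_of_ne ha.1.1 fun h => by
    have := ha.2.1
    rw [← h] at this
    exact lt_irrefl _ this
  rw [Metric.mem_closure_iff]
  intro ε hε
  set x := max (a - ε / 2) 0 with hx
  have hxa : x < a := max_lt (by linarith) ha0
  have hx0 : 0 ≤ x := le_max_right _ _
  have h1 := (hg.contPart_tendsto_left ha0).eventually (lt_mem_nhds (ha.2.2 x ⟨hx0, hxa⟩))
  obtain ⟨s, hs1, hs2⟩ := (h1.and (Ioo_mem_nhdsLT hxa)).exists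
  have hsI : s ∈ Icc 0 T := ⟨hx0.trans hs2.1.le, hs2.2.le.trans ha.1.2⟩
  obtain ⟨b, hbR, hbs, hbG⟩ := hg.exists_leftStrict hsI ((hg.contPart_mono le_rfl hx0).trans_lt hs1)
  have hxb : x < b := by
    by_contra hcon
    have := hg.contPart_mono hbR.1.1 (not_lt.1 hcon)
    linarith
  have hba : b < a := hbs.trans_lt hs2.2
  refine ⟨b, ⟨hbR, hba⟩, ?_⟩
  rw [Real.dist_eq, abs_of_pos (by linarith)]
  have := le_max_left (a - ε / 2) 0
  linarith

/-- The two derivatives agree at the points where `g^C` increases from the left. -/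
lemma RegularOn.deriv_eq_deriv_contPart (hg : RegularOn g T) (hF : MemBC g 0 T 0 F)
    (hH : MemBC g 0 T 0 H) (hFH : ∀ t ∈ Icc 0 T, HasGDerivAt g 0 T F (H t) t)
    (hee : ∀ t ∈ Icc 0 T, HasGDerivAt (contPart g 0) 0 T e (e' t) t)
    (hA : ∀ a ∈ leftStrict g T, F a = e a)
    (hB : ∀ t ∈ Icc 0 T, t ∈ jumpSet g → contPart g 0 0 < contPart g 0 t → H t = 0)
    {a : ℝ} (ha : a ∈ leftStrict g T) : H a = e' a := by
  have hd := hg.toIsDerivator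
  have ha0 : 0 < a := lt_of_le_of_ne ha.1.1 fun h => by
    have := ha.2.1
    rw [← h] at this
    exact lt_irrefl _ this
  have hnC : a ∉ constSet (contPart g 0) := by
    rintro ⟨ε, hε, h⟩
    have hm : max (a - ε / 2) 0 < a := max_lt (by linarith) ha0
    refine (ha.2.2 _ ⟨le_max_right (a - ε / 2) 0, hm⟩).ne (h _ ⟨?_, by linarith⟩)
    exact lt_of_lt_of_le (by linarith) (le_max_left _ _)
  have h1 := (hee a ha.1).1 (by
    rintro (h | h)
    · exact hd.jump_contPart ha0.le h
    · exact hnC h)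
  -- Along `l` the increments of `e` and `F` agree, and those of `F` are integrals of `H` that see
  -- only `g^C`. Left continuity of `H` then makes the quotients tend to `H a`.
  set l := 𝓝[leftStrict g T ∩ Iio a] a
  have hl : l.NeBot := mem_closure_iff_nhdsWithin_neBot.1 (hd.mem_closure_leftStrict ha)
  have h2 : Tendsto (quot (contPart g 0) e a) l (𝓝 (e' a)) := h1.mono_left (nhdsWithin_mono _
    fun s hs => ⟨hs.1.1, (ha.2.2 s ⟨hs.1.1.1, hs.2⟩).ne⟩)
  refine tendsto_nhds_unique ?_ h2
  rw [Metric.tendsto_nhds]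
  intro ε hε
  have h3 := Metric.tendsto_nhds.1 (hH.1.continuousWithinAt_left hd ha.1).tendsto (ε / 2)
    (by positivity)
  rw [eventually_nhdsWithin_iff, Metric.eventually_nhds_iff] at h3
  obtain ⟨δ, hδ, h3⟩ := h3
  have h4 : ∀ᶠ s in l, dist s a < δ := nhdsWithin_le_nhds (Metric.ball_mem_nhds a hδ)
  filter_upwards [h4, self_mem_nhdsWithin] with s hsd hs
  have hsa : s < a := hs.2
  have hs0 := hs.1.1.1
  have hlt := ha.2.2 s ⟨hs0, hsa⟩
  have h5 := hd.norm_int_sub_contPart_le hH hs0 hsa.le ha.1.2 (x := H a) (C := ε / 2)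
    (fun r hr hrD => hB r ⟨hs0.trans hr.1, hr.2.le.trans ha.1.2⟩ hrD
      (hs.1.2.1.trans_le (hd.contPart_mono hs0 hr.1)))
    fun r hr _ => by
      rw [← dist_eq_norm]
      refine (h3 ?_ ⟨⟨hs0.trans hr.1, hr.2.le.trans ha.1.2⟩, hr.2.le⟩).le
      rw [Real.dist_eq, abs_sub_comm, abs_of_pos (by linarith [hr.2])]
      rw [Real.dist_eq, abs_sub_comm, abs_of_pos (by linarith)] at hsd
      linarith [hr.1]
  have h6 : hd.int H a - hd.int H s = F a - F s := by
    rw [hg.eq_add_int hF hH hFH ha.1, hg.eq_add_int hF hH hFH hs.1.1]; ring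
  have h7 := quot_mul_sub (f := e) hlt.ne
  rw [h6, hA a ha, hA s hs.1, ← norm_neg, show -(e a - e s
    - H a * ((contPart g 0 a - contPart g 0 s : ℝ) : 𝕜))
    = (e s - e a) - H a * ((contPart g 0 s - contPart g 0 a : ℝ) : 𝕜) by push_cast; ring, ← h7,
    ← sub_mul, norm_mul, RCLike.norm_ofReal, abs_of_neg (by linarith), neg_sub] at h5
  rw [dist_eq_norm]
  have := le_of_mul_le_mul_right h5 (by linarith)
  linarith

/-- The `g`-derivatives of a function that is also `g^C`-smooth vanish at the jumps beyond the
initial level of `g^C`. -/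
lemma RegularOn.vanish (hg : RegularOn g T) {n : ℕ} {γ η : ℕ → ℝ → 𝕜} (h0 : γ 0 = η 0)
    (hγ : ∀ k ≤ n + 1, MemBC g 0 T 0 (γ k))
    (hγd : ∀ k < n + 1, ∀ t ∈ Icc 0 T, HasGDerivAt g 0 T (γ k) (γ (k + 1) t) t)
    (hη : ∀ k ≤ n, GContinuousOn (contPart g 0) 0 T (η k))
    (hηd : ∀ k < n, ∀ t ∈ Icc 0 T, HasGDerivAt (contPart g 0) 0 T (η k) (η (k + 1) t) t)
    (k : ℕ) (hk : k ≤ n) :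
    (∀ a ∈ leftStrict g T, γ k a = η k a) ∧ ∀ t ∈ Icc 0 T, t ∈ jumpSet g →
      contPart g 0 0 < contPart g 0 t → γ (k + 1) t = 0 := by
  induction k with
  | zero =>
    refine ⟨fun a _ => by rw [h0], fun t ht htD _ => ?_⟩
    exact hg.deriv_eq_zero_of_contPart (h0 ▸ hη 0 hk) (hγd 0 (by omega)) ht htD
  | succ k ih =>
    obtain ⟨hA, hB⟩ := ih (by omega)
    have hA' : ∀ a ∈ leftStrict g T, γ (k + 1) a = η (k + 1) a := fun a ha =>
      hg.deriv_eq_deriv_contPart (hγ k (by omega)) (hγ (k + 1) (by omega)) (hγd k (by omega))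
        (hηd k (by omega)) hA hB ha
    exact ⟨hA', fun t ht htD htG => hg.vanish_succ (hγ k (by omega)) (hγ (k + 1) (by omega))
      (hγd k (by omega)) (hγd (k + 1) (by omega)) (hη (k + 1) hk) hA' hB ht htD htG⟩

/-- The zero function represents every product of a derivative with `Δ⁺g`. -/
lemma RegularOn.goodMul_of_vanish_all (hg : RegularOn g T) {n : ℕ} {γ : ℕ → ℝ → 𝕜}
    (hγ : ∀ k ≤ n, MemBC g 0 T 0 (γ k))
    (hder : ∀ k < n, ∀ t ∈ Icc 0 T, HasGDerivAt g 0 T (γ k) (γ (k + 1) t) t)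
    (hvan : ∀ k, 1 ≤ k → k ≤ n → ∀ t ∈ Icc 0 T, t ∈ jumpSet g → γ k t = 0)
    {m k : ℕ} (hkm : k + m = n) : GoodMul g T m (γ k) := by
  induction m generalizing k with
  | zero => exact hγ k (by omega)
  | succ m ih =>
    refine ⟨hγ k (by omega), γ (k + 1), hder k (by omega), ih (by omega), fun _ => 0,
      hg.goodMul_zero m, fun t ht _ => ?_⟩
    by_cases htD : t ∈ jumpSet g
    · rw [hvan (k + 1) (by omega) (by omega) t ht htD, zero_mul]
    · rw [hg.toIsDerivator.jump_eq_zero htD]; simp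

lemma RegularOn.goodMul (hg : RegularOn g T) {n : ℕ} {β : ℝ → 𝕜} (hβ : MemBC g 0 T (n + 1) β)
    (hβC : MemBC (contPart g 0) 0 T n β) : GoodMul g T (n + 1) β := by
  have hd := hg.toIsDerivator
  obtain ⟨γ, rfl, hγ, hγd⟩ := hβ.exists_seq
  obtain ⟨η, hη0, hη, hηd⟩ := hβC.exists_seq
  have hv := hg.vanish hη0.symm (fun k hk => (hγ k hk).toZero) hγd
    (fun k hk => (hη k hk).gContinuousOn) hηd
  have hpos : ∀ k, 1 ≤ k → k ≤ n + 1 → ∀ t ∈ Icc 0 T, t ∈ jumpSet g →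
      contPart g 0 0 < contPart g 0 t → γ k t = 0 := by
    intro k hk1 hkn t ht htD htG
    obtain ⟨k, rfl⟩ := Nat.exists_eq_add_of_le' hk1
    exact (hv k (by omega)).2 t ht htD htG
  have hone : ∀ t ∈ Icc 0 T, t ∈ jumpSet g → γ 1 t = 0 := fun t ht htD =>
    hg.deriv_eq_zero_of_contPart hβC.gContinuousOn (hγd 0 (by omega)) ht htD
  have hinit : ∀ t ∈ Icc 0 T, contPart g 0 t = contPart g 0 0 → ∀ s ∈ Icc 0 t, γ 0 s = γ 0 0 := by
    intro t ht htG s hs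
    refine hβC.gContinuousOn.eq_of_eq ⟨hs.1, hs.2.trans ht.2⟩ ⟨le_rfl, hg.pos.le⟩ ?_
    exact le_antisymm (htG ▸ hd.contPart_mono hs.1 hs.2) (hd.contPart_mono le_rfl hs.1)
  -- Beyond the initial level of `g^C`, `hpos` settles the matter. What remains depends on whether
  -- the jumps inside this level have a last one.
  by_cases hmax : ∃ c ∈ Icc 0 T, c ∈ jumpSet g ∧ contPart g 0 c = contPart g 0 0 ∧
      ∀ t ∈ Icc 0 T, t ∈ jumpSet g → contPart g 0 t = contPart g 0 0 → t ≤ c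
  · obtain ⟨c, hc, hcD, hcG, hcmax⟩ := hmax
    have hvan : ∀ k, 1 ≤ k → k ≤ n + 1 → ∀ t ∈ Icc 0 T, t ∈ jumpSet g → c < t → γ k t = 0 := by
      intro k hk1 hkn t ht htD hct
      refine hpos k hk1 hkn t ht htD (lt_of_le_of_ne (hd.contPart_mono le_rfl ht.1) fun h => ?_)
      exact absurd (hcmax t ht htD h.symm) (not_le.2 hct)
    have hzero : EqOn (γ 1) 0 (Icc 0 c) := by
      intro s hs
      rcases (hg.monotone hs.2).eq_or_lt with h | h
      · rw [(hγ 1 (by omega)).gContinuousOn.eq_of_eq (t := c) ⟨hs.1, hs.2.trans hc.2⟩ hc h]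
        exact hone c hc hcD
      · refine hg.deriv_eq_zero (hγ 1 (by omega)).gContinuousOn (hγd 0 (by omega)) hs.1 hc.2
          (fun r hr => ?_) h
        rw [hinit c hc hcG r ⟨hs.1.trans hr.1, hr.2⟩, hinit c hc hcG s hs]
    -- `γ 0` is constant on `[0, c]` but not necessarily a combination of level indicators, so the
    -- induction starts at `γ 1` with the zero combination.
    refine ⟨(hγ 0 (by omega)).toZero, γ 1, hγd 0 (by omega),
      hg.goodMul_of_vanish hγ hγd hc hcD hvan (by omega) (Submodule.zero_mem _) hzero,
      fun _ => 0, hg.goodMul_zero n, fun t ht _ => ?_⟩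
    by_cases htD : t ∈ jumpSet g
    · rw [hone t ht htD, zero_mul]
    · rw [hd.jump_eq_zero htD]; simp
  · push Not at hmax
    -- Every jump `t` of the initial level is followed by another, `t'`. Constancy of one derivative
    -- on `[0, t']` makes the next vanish on `[0, t]`, so `t'` absorbs the loss at each order.
    have hlow : ∀ k ≤ n, ∀ t ∈ Icc 0 T, t ∈ jumpSet g → contPart g 0 t = contPart g 0 0 →
        ∀ s ∈ Icc 0 t, γ (k + 1) s = 0 := by
      intro k
      induction k with
      | zero =>
        intro hk t ht htD htG s hs
        obtain ⟨t', ht', ht'D, ht'G, htt'⟩ := hmax t ht htD htG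
        refine hg.deriv_eq_zero (hγ 1 (by omega)).gContinuousOn (hγd 0 (by omega)) hs.1 ht'.2
          (fun r hr => ?_) ((hg.monotone hs.2).trans_lt (hd.lt_of_mem_jumpSet htD htt'))
        rw [hinit t' ht' ht'G r ⟨hs.1.trans hr.1, hr.2⟩,
          hinit t' ht' ht'G s ⟨hs.1, hs.2.trans htt'.le⟩]
      | succ k ih =>
        intro hk t ht htD htG s hs
        obtain ⟨t', ht', ht'D, ht'G, htt'⟩ := hmax t ht htD htG
        refine hg.deriv_eq_zero (hγ (k + 2) (by omega)).gContinuousOn (hγd (k + 1) (by omega))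
          hs.1 ht'.2 (fun r hr => ?_)
          ((hg.monotone hs.2).trans_lt (hd.lt_of_mem_jumpSet htD htt'))
        rw [ih (by omega) t' ht' ht'D ht'G r ⟨hs.1.trans hr.1, hr.2⟩,
          ih (by omega) t' ht' ht'D ht'G s ⟨hs.1, hs.2.trans htt'.le⟩]
    refine hg.goodMul_of_vanish_all (fun k hk => (hγ k hk).toZero) hγd ?_ (Nat.zero_add _)
    intro k hk1 hkn t ht htD
    rcases (hd.contPart_mono le_rfl ht.1).eq_or_lt with h | h
    · obtain ⟨k, rfl⟩ := Nat.exists_eq_add_of_le' hk1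
      exact hlow k (by omega) t ht htD h.symm t ⟨ht.1, le_rfl⟩
    · exact hpos k hk1 hkn t ht htD h

end Compare

end Stieltjes

end

theorem mainTheorem7 {𝕜 : Type*} [RCLike 𝕜] (g : ℝ → ℝ) (hg : Stieltjes.IsDerivator g)
    (T : ℝ) (hT : 0 < T) (hg0 : ContinuousAt g 0)
    (h0 : (0 : ℝ) ∉ Stieltjes.leftEnds g)
    (hTN : T ∉ Stieltjes.constSet g ∪ Stieltjes.rightEnds g ∪ Stieltjes.jumpSet g) :
    (∀ n : ℕ, 1 ≤ n → ∀ (β f : ℝ → 𝕜) (v₀ : 𝕜),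
      Stieltjes.MemBC g 0 T n β →
      Stieltjes.MemBC (Stieltjes.contPart g 0) 0 T (n - 1) β →
      Stieltjes.MemBC g 0 T n f →
      Stieltjes.HasUniqueSolutionInBC g T (n + 1) (fun t x => β t * x + f t) v₀) ∧
    (∀ n : ℕ, 1 ≤ n → ∀ (β : ℝ → 𝕜) (v₀ : 𝕜),
      Stieltjes.MemBC g 0 T n β →
      Stieltjes.MemBC (Stieltjes.contPart g 0) 0 T (n - 1) β →
      Stieltjes.HasUniqueSolutionInBC g T (n + 1) (fun t x => β t * x) v₀) ∧
    (∀ (β : ℝ → 𝕜) (v₀ : 𝕜),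
      Stieltjes.MemBC g 0 T 0 β →
      Stieltjes.HasUniqueSolutionInBC g T 1 (fun t x => β t * x) v₀) := by
  have hr : Stieltjes.RegularOn g T := ⟨hg, hT, h0, hTN⟩
  -- The homogeneous problem is the case `f = 0`. At order `0`, `GoodMul` is just membership in
  -- `BC_g^0`, which gives the third claim.
  have hom : ∀ (n : ℕ) (β : ℝ → 𝕜) (v₀ : 𝕜), Stieltjes.GoodMul g T n β →
      Stieltjes.HasUniqueSolutionInBC g T (n + 1) (fun t x => β t * x) v₀ := fun n β v₀ hβ => by
    simpa using hr.hasUniqueSolutionInBC v₀ hβ (hr.goodMul_zero n).memBC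
  refine ⟨fun n hn β f v₀ hβ hβC hf => ?_, fun n hn β v₀ hβ hβC => ?_, fun β v₀ hβ => hom 0 β v₀ hβ⟩
  · obtain ⟨n, rfl⟩ := Nat.exists_eq_add_of_le' hn
    exact hr.hasUniqueSolutionInBC v₀ (hr.goodMul hβ hβC) hf
  · obtain ⟨n, rfl⟩ := Nat.exists_eq_add_of_le' hn
    exact hom _ β v₀ (hr.goodMul hβ hβC)
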